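/- Let $A,B$ be $n\times n$ complex matrices with $-B^\dagger A+A^\dagger B=0$ and $A^\dagger A+B^\dagger B>0$, and let $V$ be an $n\times n$ matrix-valued function on $(0,\infty)$ that is measurable, selfadjoint, $V(x)=V(x)^\dagger$ for $x>0$, and integrable, $\int_0^\infty\|V(x)\|\,dx<\infty$. Write $L^2=L^2((0,\infty);\mathbf C^n)$, let $\mathbf H_l$ be the Sobolev space of order $l$ of functions in $L^2$, and let $H_{1,0}$ be the closure of $C_0^\infty((0,\infty))$ in the scalar first-order Sobolev space. Let $H_{0,A,B}$ be the operator $\psi\mapsto-\psi''$ in $L^2$ with domain $\{\psi\in\mathbf H_2:\ -B^\dagger\psi(0)+A^\dagger\psi'(0)=0\}$, and let $H_0:=H_{0,-I,0}$ (Neumann boundary condition). A *diagonal representation* of $(A,B)$ consists of a unitary matrix $M$ and angles $\theta_1,\dots,\theta_n\in(0,\pi]$ such that $A=M\tilde A\,T_2M^\dagger T_1$ and $B=M\tilde B\,T_2M^\dagger T_1$ for some invertible matrices $T_1,T_2$, where $\tilde A=-\mathrm{diag}(\sin\theta_1,\dots,\sin\theta_n)$ and $\tilde B=\mathrm{diag}(\cos\theta_1,\dots,\cos\theta_n)$.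 Call the index $j$ *mixed* if $\theta_j\ne\pi/2,\pi$. Given such a representation, let $\Theta$ be the diagonal matrix with entries $\cot\theta_j$ for mixed $j$ and $0$ otherwise, and let $H_{A,B}$ be the operator in $L^2$ associated with the quadratic form $$h_{A,B}(\varphi,\psi)=(\varphi',\psi')-\langle M\Theta M^\dagger\varphi(0),\psi(0)\rangle+(V\varphi,\psi)$$ with domain $\{\varphi\in\mathbf H_1:\ (M^\dagger\varphi)_j\in H_{1,0}\text{ whenever }\theta_j=\pi\}$; that is, $\varphi\in D(H_{A,B})$ and $H_{A,B}\varphi=w$ if and only if $\varphi$ lies in the form domain, $w\in L^2$, and $h_{A,B}(\varphi,\psi)=(w,\psi)$ for all $\psi$ in the form domain. Denote by $\rho(\cdot)$ the resolvent set and by $R_{A,B}(z)=(H_{A,B}-z)^{-1}$, $R_{0,A,B}(z)=(H_{0,A,B}-z)^{-1}$, $R_0(z)=(H_0-z)^{-1}$ the resolvents, by $\|\cdot\|_1$ the trace norm, and by $\sqrt z$ the square root with $\operatorname{Im}\sqrt z\ge0$. For $k\in\mathbf C$ put $$D(k)=\max\Big[\frac1{|k|},\ \frac1{|\cos\theta_j+ik\sin\theta_j|}\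 (j\text{ mixed})\Big],\qquad F(k)=\max\Big[1,\ \frac{1+|k|}{|\cos\theta_j+ik\sin\theta_j|}\ (j\text{ mixed})\Big].$$ Then: (a) $(A,B)$ has a diagonal representation. (b) For every diagonal representation of $(A,B)$ and every $z\in\rho(H_{A,B})\cap\rho(H_{0,A,B})$, the operator $R_{A,B}(z)-R_{0,A,B}(z)$ is trace class. (c) For every $z\in\rho(H_{0,A,B})\cap\rho(H_0)$, the operator $R_{0,A,B}(z)-R_0(z)$ is trace class. (d) There is a constant $C>0$, depending neither on $z$ nor on the choice of the diagonal representation, such that for every diagonal representation of $(A,B)$ and every $z\in\rho(H_{0,A,B})\cap\rho(H_0)$, $$\big\|R_{0,A,B}(z)-R_0(z)\big\|_1\le C\,D(\sqrt z)\,F(\sqrt{\overline z})\,\frac1{\operatorname{Im}\sqrt z}.$$ -/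

import Mathlib

open MeasureTheory Set
open scoped Matrix ContDiff ComplexOrder ENNReal

noncomputable section

namespace HalfLine

/-! ### Sobolev spaces on the half line `(0, ∞)` -/

/-- Lebesgue measure on `(0, ∞)`. -/
abbrev halfLine : Measure ℝ := volume.restrict (Ioi 0)

/-- `L²((0, ∞); E)`. -/
abbrev L2 (E : Type*) [NormedAddCommGroup E] : Type _ := Lp E 2 halfLine

/-- `ℂⁿ` with its Euclidean norm. -/
abbrev Cn (n : ℕ) : Type := EuclideanSpace ℂ (Fin n)

/-- `φ ∈ C₀^∞((0, ∞))`, complex valued. -/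
def IsTest (φ : ℝ → ℂ) : Prop :=
  ContDiff ℝ ∞ φ ∧ HasCompactSupport φ ∧ tsupport φ ⊆ Ioi 0

variable {E : Type*} [NormedAddCommGroup E] [NormedSpace ℂ E]

/-- `g` is the distributional derivative of `f` on `(0, ∞)`. -/
def HasWeakDeriv (f g : L2 E) : Prop :=
  ∀ φ : ℝ → ℂ, IsTest φ →
    ∫ x in Ioi (0 : ℝ), deriv φ x • f x = - ∫ x in Ioi (0 : ℝ), φ x • g x

/-- `a` is the value at `0` of the representative of `f` that is continuous on `[0, ∞)`. -/
def HasBoundaryValue (f : L2 E) (a : E) : Prop :=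
  ∃ u : ℝ → E, ContinuousOn u (Ici 0) ∧ f =ᵐ[halfLine] u ∧ u 0 = a

/-- The space `H_{1,0}`: the closure of `C₀^∞((0, ∞))` in the first Sobolev space
of scalar functions, for the norm of that space. -/
def H10 : Set (L2 ℂ) :=
  {f | ∃ g : L2 ℂ, HasWeakDeriv f g ∧ ∀ ε : ℝ≥0∞, 0 < ε → ∃ φ : ℝ → ℂ, IsTest φ ∧
    eLpNorm (fun x => φ x - f x) 2 halfLine < ε ∧
    eLpNorm (fun x => deriv φ x - g x) 2 halfLine < ε}

/-- The `j`-th component of the function `x ↦ T (f x)`, for a constant matrix `T`. -/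
def component {n : ℕ} (T : Matrix (Fin n) (Fin n) ℂ) (j : Fin n) : L2 (Cn n) →L[ℂ] L2 ℂ :=
  ((EuclideanSpace.proj j : Cn n →L[ℂ] ℂ) ∘L Matrix.toEuclideanCLM (𝕜 := ℂ) T).compLpL 2 halfLine

/-! ### Facts needed to see that the operators below are single valued -/

theorem integrable_test_smul {φ : ℝ → ℂ} (hc : Continuous φ) (hs : HasCompactSupport φ)
    (f : L2 E) : Integrable (fun x => φ x • f x) halfLine := by
  have h1 : MemLp φ 2 halfLine := (hc.memLp_of_hasCompactSupport hs)
  exact memLp_one_iff_integrable.mp ((Lp.memLp f).smul h1)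

theorem IsTest.continuous_deriv {φ : ℝ → ℂ} (h : IsTest φ) : Continuous (deriv φ) :=
  h.1.continuous_deriv (by simp)

theorem HasWeakDeriv.add {f g f' g' : L2 E} (hf : HasWeakDeriv f f') (hg : HasWeakDeriv g g') :
    HasWeakDeriv (f + g) (f' + g') := by
  intro φ hφ
  have e1 : ∫ x in Ioi (0 : ℝ), deriv φ x • (f + g : L2 E) x
      = ∫ x in Ioi (0 : ℝ), (deriv φ x • f x + deriv φ x • g x) := by
    refine integral_congr_ae ?_
    filter_upwards [Lp.coeFn_add f g] with x hx
    rw [hx, Pi.add_apply, smul_add]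
  have e2 : ∫ x in Ioi (0 : ℝ), φ x • (f' + g' : L2 E) x
      = ∫ x in Ioi (0 : ℝ), (φ x • f' x + φ x • g' x) := by
    refine integral_congr_ae ?_
    filter_upwards [Lp.coeFn_add f' g'] with x hx
    rw [hx, Pi.add_apply, smul_add]
  rw [e1, e2, integral_add, integral_add, hf φ hφ, hg φ hφ, neg_add]
  · exact integrable_test_smul hφ.1.continuous hφ.2.1 f'
  · exact integrable_test_smul hφ.1.continuous hφ.2.1 g'
  · exact integrable_test_smul hφ.continuous_deriv hφ.2.1.deriv f
  · exact integrable_test_smul hφ.continuous_deriv hφ.2.1.deriv g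

theorem HasWeakDeriv.smul (c : ℂ) {f f' : L2 E} (hf : HasWeakDeriv f f') :
    HasWeakDeriv (c • f) (c • f') := by
  intro φ hφ
  have e1 : ∫ x in Ioi (0 : ℝ), deriv φ x • (c • f : L2 E) x
      = ∫ x in Ioi (0 : ℝ), c • (deriv φ x • f x) := by
    refine integral_congr_ae ?_
    filter_upwards [Lp.coeFn_smul c f] with x hx
    rw [hx, Pi.smul_apply, smul_comm]
  have e2 : ∫ x in Ioi (0 : ℝ), φ x • (c • f' : L2 E) x
      = ∫ x in Ioi (0 : ℝ), c • (φ x • f' x) := by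
    refine integral_congr_ae ?_
    filter_upwards [Lp.coeFn_smul c f'] with x hx
    rw [hx, Pi.smul_apply, smul_comm]
  rw [e1, e2, integral_smul, integral_smul, hf φ hφ, smul_neg]

theorem HasWeakDeriv.zero : HasWeakDeriv (0 : L2 E) 0 := by
  have e (ψ : ℝ → ℂ) : ∫ x in Ioi (0 : ℝ), ψ x • (0 : L2 E) x = 0 := by
    refine integral_eq_zero_of_ae ?_
    filter_upwards [Lp.coeFn_zero E 2 halfLine] with x hx
    rw [hx, Pi.zero_apply, smul_zero]
  intro φ _
  rw [e, e, neg_zero]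

/-- A function in `L²((0, ∞); E)` that integrates to zero against all test functions vanishes. -/
theorem eq_zero_of_forall_test [CompleteSpace E] {g : L2 E}
    (h : ∀ φ : ℝ → ℂ, IsTest φ → ∫ x in Ioi (0 : ℝ), φ x • g x = 0) : g = 0 := by
  have hloc : LocallyIntegrable g halfLine := (Lp.memLp g).locallyIntegrable (by norm_num)
  have := isOpen_Ioi.ae_eq_zero_of_integral_contDiff_smul_eq_zero (U := Ioi (0 : ℝ))
    (μ := halfLine) (f := g) (hloc.locallyIntegrableOn _) ?_
  · refine (Lp.eq_zero_iff_ae_eq_zero).mpr ?_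
    filter_upwards [this, ae_restrict_mem measurableSet_Ioi] with x hx hx0
    exact hx hx0
  · intro φ hφ hc hs
    have ht : IsTest (fun x => (φ x : ℂ)) := by
      refine ⟨Complex.ofRealCLM.contDiff.comp hφ,
        hc.comp_left (g := fun r : ℝ => (r : ℂ)) Complex.ofReal_zero, ?_⟩
      exact (closure_mono (Function.support_comp_subset (g := fun r : ℝ => (r : ℂ))
        Complex.ofReal_zero φ)).trans hs
    rw [← h _ ht]
    exact integral_congr_ae (Filter.Eventually.of_forall fun x => (Complex.coe_smul (φ x) (g x)).symm)

theorem HasWeakDeriv.eq_zero [CompleteSpace E] {g : L2 E} (h : HasWeakDeriv (0 : L2 E) g) :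
    g = 0 := by
  refine eq_zero_of_forall_test fun φ hφ => ?_
  have e : ∫ x in Ioi (0 : ℝ), deriv φ x • (0 : L2 E) x = 0 := by
    refine integral_eq_zero_of_ae ?_
    filter_upwards [Lp.coeFn_zero E 2 halfLine] with x hx
    rw [hx, Pi.zero_apply, smul_zero]
  have := h φ hφ
  rw [e] at this
  exact neg_eq_zero.mp this.symm

theorem HasBoundaryValue.add {f g : L2 E} {a b : E} (hf : HasBoundaryValue f a)
    (hg : HasBoundaryValue g b) : HasBoundaryValue (f + g) (a + b) := by
  obtain ⟨u, hu, hfu, hu0⟩ := hf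
  obtain ⟨v, hv, hgv, hv0⟩ := hg
  refine ⟨u + v, hu.add hv, ?_, by simp [hu0, hv0]⟩
  exact (Lp.coeFn_add f g).trans (hfu.add hgv)

theorem HasBoundaryValue.smul (c : ℂ) {f : L2 E} {a : E} (hf : HasBoundaryValue f a) :
    HasBoundaryValue (c • f) (c • a) := by
  obtain ⟨u, hu, hfu, hu0⟩ := hf
  refine ⟨c • u, hu.const_smul c, ?_, by simp [hu0]⟩
  exact (Lp.coeFn_smul c f).trans (hfu.const_smul c)

theorem HasBoundaryValue.zero : HasBoundaryValue (0 : L2 E) 0 :=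
  ⟨0, continuousOn_const, Lp.coeFn_zero E 2 halfLine, rfl⟩

theorem HasBoundaryValue.eq_zero {a : E} (h : HasBoundaryValue (0 : L2 E) a) : a = 0 := by
  obtain ⟨u, hu, h0, rfl⟩ := h
  have h1 : u =ᵐ[halfLine] fun _ => (0 : E) := h0.symm.trans (Lp.coeFn_zero E 2 halfLine)
  have h2 : EqOn u (fun _ => (0 : E)) (Ioi 0) :=
    Measure.eqOn_of_ae_eq h1 (hu.mono Ioi_subset_Ici_self) continuousOn_const
      (by rw [isOpen_Ioi.interior_eq]; exact subset_closure)
  have h3 : EqOn u (fun _ => (0 : E)) (Ici 0) :=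
    h2.of_subset_closure hu continuousOn_const Ioi_subset_Ici_self (by rw [closure_Ioi])
  exact h3 (mem_Ici.mpr le_rfl)

theorem H10.add {f g : L2 ℂ} (hf : f ∈ H10) (hg : g ∈ H10) : f + g ∈ H10 := by
  obtain ⟨f', hf', hf⟩ := hf
  obtain ⟨g', hg', hg⟩ := hg
  refine ⟨f' + g', hf'.add hg', fun ε hε => ?_⟩
  obtain ⟨φ, hφ, h1, h2⟩ := hf (ε / 2) (ENNReal.half_pos hε.ne')
  obtain ⟨ψ, hψ, h3, h4⟩ := hg (ε / 2) (ENNReal.half_pos hε.ne')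
  have hd : deriv (φ + ψ) = deriv φ + deriv ψ := by
    funext x
    exact deriv_add (hφ.1.differentiable (by simp) x) (hψ.1.differentiable (by simp) x)
  refine ⟨φ + ψ, ⟨hφ.1.add hψ.1, hφ.2.1.add hψ.2.1,
    (tsupport_add φ ψ).trans (union_subset hφ.2.2 hψ.2.2)⟩, ?_, ?_⟩
  · have e : (fun x => (φ + ψ) x - (f + g : L2 ℂ) x) =ᵐ[halfLine]
        (fun x => φ x - f x) + fun x => ψ x - g x := by
      filter_upwards [Lp.coeFn_add f g] with x hx
      simp only [hx, Pi.add_apply]; ring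
    rw [eLpNorm_congr_ae e]
    refine (eLpNorm_add_le (hφ.1.continuous.aestronglyMeasurable.sub (Lp.aestronglyMeasurable f))
      (hψ.1.continuous.aestronglyMeasurable.sub (Lp.aestronglyMeasurable g))
      (by norm_num)).trans_lt ?_
    exact (ENNReal.add_lt_add h1 h3).trans_eq (ENNReal.add_halves ε)
  · have e : (fun x => deriv (φ + ψ) x - (f' + g' : L2 ℂ) x) =ᵐ[halfLine]
        (fun x => deriv φ x - f' x) + fun x => deriv ψ x - g' x := by
      filter_upwards [Lp.coeFn_add f' g'] with x hx
      simp only [hx, hd, Pi.add_apply]; ring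
    rw [eLpNorm_congr_ae e]
    refine (eLpNorm_add_le
      (hφ.continuous_deriv.aestronglyMeasurable.sub (Lp.aestronglyMeasurable f'))
      (hψ.continuous_deriv.aestronglyMeasurable.sub (Lp.aestronglyMeasurable g'))
      (by norm_num)).trans_lt ?_
    exact (ENNReal.add_lt_add h2 h4).trans_eq (ENNReal.add_halves ε)

theorem H10.smul (c : ℂ) {f : L2 ℂ} (hf : f ∈ H10) : c • f ∈ H10 := by
  obtain ⟨f', hf', hf⟩ := hf
  refine ⟨c • f', hf'.smul c, fun ε hε => ?_⟩
  have hne : ‖c‖ₑ + 1 ≠ ⊤ := by simp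
  obtain ⟨φ, hφ, h1, h2⟩ := hf (ε / (‖c‖ₑ + 1)) (ENNReal.div_pos hε.ne' hne)
  have key (t : ℝ≥0∞) (ht : t < ε / (‖c‖ₑ + 1)) : ‖c‖ₑ * t < ε := by
    refine lt_of_le_of_lt ?_ (ENNReal.mul_lt_of_lt_div' ht)
    gcongr
    exact le_self_add
  have hd : deriv (c • φ) = c • deriv φ := by
    funext x
    exact deriv_const_smul c (hφ.1.differentiable (by simp) x)
  have hsupp : tsupport (c • φ) ⊆ tsupport φ :=
    closure_mono (Function.support_const_smul_subset c φ)
  refine ⟨c • φ, ⟨hφ.1.const_smul c, hφ.2.1.mono' ?_, hsupp.trans hφ.2.2⟩, ?_, ?_⟩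
  · exact subset_closure.trans hsupp
  · have e : (fun x => (c • φ) x - (c • f : L2 ℂ) x) =ᵐ[halfLine]
        c • fun x => φ x - f x := by
      filter_upwards [Lp.coeFn_smul c f] with x hx
      simp only [hx, Pi.smul_apply, smul_sub]
    rw [eLpNorm_congr_ae e, eLpNorm_const_smul]
    exact key _ h1
  · have e : (fun x => deriv (c • φ) x - (c • f' : L2 ℂ) x) =ᵐ[halfLine]
        c • fun x => deriv φ x - f' x := by
      filter_upwards [Lp.coeFn_smul c f'] with x hx
      simp only [hx, hd, Pi.smul_apply, smul_sub]
    rw [eLpNorm_congr_ae e, eLpNorm_const_smul]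
    exact key _ h2

theorem H10.zero : (0 : L2 ℂ) ∈ H10 := by
  have e : (fun x => (0 : ℝ → ℂ) x - (0 : L2 ℂ) x) =ᵐ[halfLine] 0 := by
    filter_upwards [Lp.coeFn_zero ℂ 2 halfLine] with x hx
    rw [hx]
    simp
  have hd : deriv (0 : ℝ → ℂ) = 0 := by
    funext x
    simp
  refine ⟨0, HasWeakDeriv.zero, fun ε hε => ⟨0, ⟨contDiff_const, HasCompactSupport.zero, ?_⟩,
    ?_, ?_⟩⟩
  · simp [tsupport]
  · rwa [eLpNorm_congr_ae e, eLpNorm_zero]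
  · rwa [hd, eLpNorm_congr_ae e, eLpNorm_zero]

theorem IsTest.memLp {φ : ℝ → ℂ} (h : IsTest φ) (c : E) :
    MemLp (fun x => φ x • c) 2 halfLine :=
  (h.1.continuous.smul continuous_const).memLp_of_hasCompactSupport h.2.1.smul_right

theorem IsTest.memLp_deriv {φ : ℝ → ℂ} (h : IsTest φ) (c : E) :
    MemLp (fun x => deriv φ x • c) 2 halfLine :=
  (h.continuous_deriv.smul continuous_const).memLp_of_hasCompactSupport h.2.1.deriv.smul_right

theorem IsTest.hasWeakDeriv [CompleteSpace E] {φ : ℝ → ℂ} (h : IsTest φ) (c : E) :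
    HasWeakDeriv ((h.memLp c).toLp _) ((h.memLp_deriv c).toLp _) := by
  intro ψ hψ
  have hz {F : ℝ → ℂ} (χ : ℝ → ℂ) (hF : tsupport F ⊆ Ioi 0) (x : ℝ) (hx : x ∉ Ioi (0 : ℝ)) :
      (χ x * F x) • c = 0 := by
    rw [image_eq_zero_of_notMem_tsupport fun hm => hx (hF hm), mul_zero, zero_smul]
  have e1 : ∫ x in Ioi (0 : ℝ), deriv ψ x • (h.memLp c).toLp _ x
      = (∫ x, deriv ψ x * φ x) • c := by
    rw [← integral_smul_const, ← setIntegral_eq_integral_of_forall_compl_eq_zero (hz _ h.2.2)]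
    refine integral_congr_ae ?_
    filter_upwards [(h.memLp c).coeFn_toLp] with x hx
    rw [hx, smul_smul]
  have e2 : ∫ x in Ioi (0 : ℝ), ψ x • (h.memLp_deriv c).toLp _ x
      = (∫ x, ψ x * deriv φ x) • c := by
    rw [← integral_smul_const, ← setIntegral_eq_integral_of_forall_compl_eq_zero
      (hz _ (tsupport_deriv_subset.trans h.2.2))]
    refine integral_congr_ae ?_
    filter_upwards [(h.memLp_deriv c).coeFn_toLp] with x hx
    rw [hx, smul_smul]
  have int {u v : ℝ → ℂ} (hu : Continuous u) (hv : Continuous v) (hs : HasCompactSupport v) :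
      Integrable (u * v) := (hu.mul hv).integrable_of_hasCompactSupport hs.mul_left
  rw [e1, e2, ← neg_smul]
  congr 1
  rw [integral_mul_deriv_eq_deriv_mul_of_integrable
    (fun x _ => (hψ.1.differentiable (by simp) x).hasDerivAt)
    (fun x _ => (h.1.differentiable (by simp) x).hasDerivAt)
    (int hψ.1.continuous h.continuous_deriv h.2.1.deriv)
    (int hψ.continuous_deriv h.1.continuous h.2.1)
    (int hψ.1.continuous h.1.continuous h.2.1), neg_neg]

theorem IsTest.hasBoundaryValue {φ : ℝ → ℂ} (h : IsTest φ) (c : E) :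
    HasBoundaryValue ((h.memLp c).toLp _) 0 := by
  refine ⟨fun x => φ x • c, (h.1.continuous.smul continuous_const).continuousOn,
    (h.memLp c).coeFn_toLp, ?_⟩
  have h0 : φ 0 = 0 := image_eq_zero_of_notMem_tsupport fun hm =>
    lt_irrefl (0 : ℝ) (mem_Ioi.mp (h.2.2 hm))
  simp [h0]

theorem IsTest.mem_H10 {φ : ℝ → ℂ} (h : IsTest φ) (c : ℂ) : (h.memLp c).toLp _ ∈ H10 := by
  refine ⟨(h.memLp_deriv c).toLp _, h.hasWeakDeriv c, ?_⟩
  intro ε hε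
  have hd : deriv (fun x => φ x * c) = fun x => deriv φ x * c := by
    funext x
    exact deriv_mul_const (h.1.differentiable (by simp) x) c
  have hsupp : tsupport (fun x => φ x * c) ⊆ tsupport φ := tsupport_mul_subset_left
  refine ⟨fun x => φ x * c, ⟨h.1.mul contDiff_const, h.2.1.mul_right, hsupp.trans h.2.2⟩, ?_, ?_⟩
  · refine lt_of_eq_of_lt (eLpNorm_eq_zero_of_ae_zero ?_) hε
    filter_upwards [(h.memLp c).coeFn_toLp] with x hx
    rw [hx, smul_eq_mul, sub_self]
    rfl
  · refine lt_of_eq_of_lt (eLpNorm_eq_zero_of_ae_zero ?_) hε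
    filter_upwards [(h.memLp_deriv c).coeFn_toLp] with x hx
    rw [hx, hd, smul_eq_mul, sub_self]
    rfl

/-! ### The operator with zero potential -/

variable {n : ℕ}

/-- Graph of `ψ ↦ -ψ''` on the functions `ψ` in the second Sobolev space with
`-B† ψ(0) + A† ψ'(0) = 0`. -/
def freeGraph (A B : Matrix (Fin n) (Fin n) ℂ) : Submodule ℂ (L2 (Cn n) × L2 (Cn n)) where
  carrier := {p | ∃ u' : L2 (Cn n), HasWeakDeriv p.1 u' ∧ HasWeakDeriv u' (-p.2) ∧
    ∃ a b : Cn n, HasBoundaryValue p.1 a ∧ HasBoundaryValue u' b ∧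
      -Matrix.toEuclideanCLM (𝕜 := ℂ) Bᴴ a + Matrix.toEuclideanCLM (𝕜 := ℂ) Aᴴ b = 0}
  zero_mem' := ⟨0, HasWeakDeriv.zero, by simpa using HasWeakDeriv.zero, 0, 0,
    HasBoundaryValue.zero, HasBoundaryValue.zero, by simp⟩
  add_mem' := by
    rintro p q ⟨u, hu, hu', a, b, ha, hb, hab⟩ ⟨v, hv, hv', c, d, hc, hd, hcd⟩
    refine ⟨u + v, hu.add hv, ?_, a + c, b + d, ha.add hc, hb.add hd, ?_⟩
    · rw [Prod.snd_add, neg_add]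
      exact hu'.add hv'
    · rw [map_add, map_add, neg_add, add_add_add_comm, hab, hcd, add_zero]
  smul_mem' := by
    rintro c p ⟨u, hu, hu', a, b, ha, hb, hab⟩
    refine ⟨c • u, hu.smul c, ?_, c • a, c • b, ha.smul c, hb.smul c, ?_⟩
    · rw [Prod.smul_snd, ← smul_neg]
      exact hu'.smul c
    · rw [map_smul, map_smul, ← smul_neg, ← smul_add, hab, smul_zero]

theorem freeGraph_functional (A B : Matrix (Fin n) (Fin n) ℂ) (p : L2 (Cn n) × L2 (Cn n))
    (hp : p ∈ freeGraph A B) (h0 : p.1 = 0) : p.2 = 0 := by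
  obtain ⟨u, hu, hu', -⟩ := hp
  rw [h0] at hu
  rw [hu.eq_zero] at hu'
  exact neg_eq_zero.mp hu'.eq_zero

/-- The operator `H_{0,A,B}`. -/
def freeHamiltonian (A B : Matrix (Fin n) (Fin n) ℂ) : L2 (Cn n) →ₗ.[ℂ] L2 (Cn n) :=
  (freeGraph A B).toLinearPMap

theorem freeHamiltonian_graph (A B : Matrix (Fin n) (Fin n) ℂ) :
    (freeHamiltonian A B).graph = freeGraph A B :=
  Submodule.toLinearPMap_graph_eq _ (freeGraph_functional A B)

/-- The operator `H_0`, with Neumann boundary condition. -/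
def neumannHamiltonian (n : ℕ) : L2 (Cn n) →ₗ.[ℂ] L2 (Cn n) :=
  freeHamiltonian (-1) 0

/-! ### The operator with an integrable potential -/

/-- `(A, B)` is represented, through a unitary `M` and angles `θ_j ∈ (0, π]`, by the diagonal pair
`Ã = -diag(sin θ_j)`, `B̃ = diag(cos θ_j)`. -/
structure IsDiagonalRepr (A B M : Matrix (Fin n) (Fin n) ℂ) (θ : Fin n → ℝ) : Prop where
  unitary : M ∈ Matrix.unitaryGroup (Fin n) ℂ
  angle : ∀ j, θ j ∈ Ioc 0 Real.pi
  repr : ∃ T₁ T₂ : Matrix (Fin n) (Fin n) ℂ, IsUnit T₁ ∧ IsUnit T₂ ∧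
    A = M * (-Matrix.diagonal fun j => (Real.sin (θ j) : ℂ)) * T₂ * Mᴴ * T₁ ∧
    B = M * (Matrix.diagonal fun j => (Real.cos (θ j) : ℂ)) * T₂ * Mᴴ * T₁

/-- The boundary condition with angle `t` is neither Dirichlet nor Neumann. -/
def IsMixed (t : ℝ) : Prop := t ≠ Real.pi / 2 ∧ t ≠ Real.pi

open Classical in
/-- `Θ = diag(cot θ_j)`, where the Neumann and the Dirichlet entries are replaced by `0`. -/
def bigTheta (θ : Fin n → ℝ) : Matrix (Fin n) (Fin n) ℂ :=
  Matrix.diagonal fun j => if IsMixed (θ j) then (Real.cot (θ j) : ℂ) else 0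

/-- The form domain: the functions `u` in the first Sobolev space for which the components of
`M† u` with a Dirichlet angle lie in `H_{1,0}`. -/
def formDomain (M : Matrix (Fin n) (Fin n) ℂ) (θ : Fin n → ℝ) : Set (L2 (Cn n)) :=
  {u | (∃ u' : L2 (Cn n), HasWeakDeriv u u') ∧ ∀ j, θ j = Real.pi → component Mᴴ j u ∈ H10}

/-- The quadratic form `h_{A,B}(u, v) = (u', v') - ⟨M Θ M† u(0), v(0)⟩ + (V u, v)`, linear in `u`,
for functions with derivatives `u'`, `v'` and boundary values `a`, `b`.
(Mathlib's inner products are linear in the second variable.) -/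
def formValue (V : ℝ → Matrix (Fin n) (Fin n) ℂ) (M : Matrix (Fin n) (Fin n) ℂ) (θ : Fin n → ℝ)
    (u u' : L2 (Cn n)) (a : Cn n) (v v' : L2 (Cn n)) (b : Cn n) : ℂ :=
  inner ℂ v' u' - inner ℂ b (Matrix.toEuclideanCLM (𝕜 := ℂ) (M * bigTheta θ * Mᴴ) a)
    + ∫ x in Ioi (0 : ℝ), inner ℂ (v x) (Matrix.toEuclideanCLM (𝕜 := ℂ) (V x) (u x))

/-- Graph of the operator associated with the form `h_{A,B}`: the pairs `(u, w)` with `u` in the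
form domain such that `h_{A,B}(u, v) = (w, v)` for every `v` in the form domain, where the integral
`(V u, v)` converges. -/
def hamiltonianGraph (V : ℝ → Matrix (Fin n) (Fin n) ℂ) (M : Matrix (Fin n) (Fin n) ℂ)
    (θ : Fin n → ℝ) : Submodule ℂ (L2 (Cn n) × L2 (Cn n)) where
  carrier := {p | p.1 ∈ formDomain M θ ∧ ∃ (u' : L2 (Cn n)) (a : Cn n),
    HasWeakDeriv p.1 u' ∧ HasBoundaryValue p.1 a ∧
    ∀ v ∈ formDomain M θ, ∀ (v' : L2 (Cn n)) (b : Cn n),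
      HasWeakDeriv v v' → HasBoundaryValue v b →
      Integrable (fun x => (inner ℂ (v x) (Matrix.toEuclideanCLM (𝕜 := ℂ) (V x) (p.1 x)) : ℂ))
        halfLine ∧
      formValue V M θ p.1 u' a v v' b = inner ℂ v p.2}
  zero_mem' := by
    refine ⟨⟨⟨0, HasWeakDeriv.zero⟩, fun j _ => ?_⟩, 0, 0, HasWeakDeriv.zero,
      HasBoundaryValue.zero, ?_⟩
    · rw [Prod.fst_zero, map_zero]
      exact H10.zero
    · intro v _ v' b _ _
      have e : (fun x => (inner ℂ (v x) (Matrix.toEuclideanCLM (𝕜 := ℂ) (V x)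
          ((0 : L2 (Cn n)) x)) : ℂ)) =ᵐ[halfLine] 0 := by
        filter_upwards [Lp.coeFn_zero (Cn n) 2 halfLine] with x hx
        rw [hx, Pi.zero_apply, map_zero, inner_zero_right, Pi.zero_apply]
      refine ⟨(integrable_congr e).mpr (integrable_zero _ _ _), ?_⟩
      rw [formValue, Prod.fst_zero, Prod.snd_zero, integral_eq_zero_of_ae e]
      simp
  add_mem' := by
    rintro p q ⟨⟨_, hpD⟩, u, a, hu, ha, hp⟩ ⟨⟨_, hqD⟩, w, c, hw, hc, hq⟩
    refine ⟨⟨⟨u + w, hu.add hw⟩, fun j hj => ?_⟩, u + w, a + c, hu.add hw, ha.add hc, ?_⟩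
    · rw [Prod.fst_add, map_add]
      exact H10.add (hpD j hj) (hqD j hj)
    · intro v hv v' b hv' hb
      obtain ⟨i1, f1⟩ := hp v hv v' b hv' hb
      obtain ⟨i2, f2⟩ := hq v hv v' b hv' hb
      have e : (fun x => (inner ℂ (v x) (Matrix.toEuclideanCLM (𝕜 := ℂ) (V x)
          ((p.1 + q.1 : L2 (Cn n)) x)) : ℂ)) =ᵐ[halfLine] fun x =>
          inner ℂ (v x) (Matrix.toEuclideanCLM (𝕜 := ℂ) (V x) (p.1 x)) +
          inner ℂ (v x) (Matrix.toEuclideanCLM (𝕜 := ℂ) (V x) (q.1 x)) := by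
        filter_upwards [Lp.coeFn_add p.1 q.1] with x hx
        rw [hx, Pi.add_apply, map_add, inner_add_right]
      refine ⟨(integrable_congr e).mpr (i1.add i2), ?_⟩
      rw [formValue] at f1 f2 ⊢
      rw [Prod.fst_add, Prod.snd_add, integral_congr_ae e, integral_add i1 i2, inner_add_right,
        inner_add_right, map_add, inner_add_right, ← f1, ← f2]
      ring
  smul_mem' := by
    rintro k p ⟨⟨_, hpD⟩, u, a, hu, ha, hp⟩
    refine ⟨⟨⟨k • u, hu.smul k⟩, fun j hj => ?_⟩, k • u, k • a, hu.smul k, ha.smul k, ?_⟩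
    · rw [Prod.smul_fst, map_smul]
      exact H10.smul k (hpD j hj)
    · intro v hv v' b hv' hb
      obtain ⟨i1, f1⟩ := hp v hv v' b hv' hb
      have e : (fun x => (inner ℂ (v x) (Matrix.toEuclideanCLM (𝕜 := ℂ) (V x)
          ((k • p.1 : L2 (Cn n)) x)) : ℂ)) =ᵐ[halfLine] fun x =>
          k * inner ℂ (v x) (Matrix.toEuclideanCLM (𝕜 := ℂ) (V x) (p.1 x)) := by
        filter_upwards [Lp.coeFn_smul k p.1] with x hx
        rw [hx, Pi.smul_apply, map_smul, inner_smul_right]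
      refine ⟨(integrable_congr e).mpr (i1.const_mul k), ?_⟩
      rw [formValue] at f1 ⊢
      rw [Prod.smul_fst, Prod.smul_snd, integral_congr_ae e, integral_const_mul, inner_smul_right,
        inner_smul_right, map_smul, inner_smul_right, ← f1]
      ring

theorem hamiltonianGraph_functional (V : ℝ → Matrix (Fin n) (Fin n) ℂ)
    (M : Matrix (Fin n) (Fin n) ℂ) (θ : Fin n → ℝ) (p : L2 (Cn n) × L2 (Cn n))
    (hp : p ∈ hamiltonianGraph V M θ) (h0 : p.1 = 0) : p.2 = 0 := by
  obtain ⟨p, w⟩ := p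
  obtain ⟨-, u', a, hu, ha, h⟩ := hp
  simp only at h0 hu ha h ⊢
  subst h0
  obtain rfl := hu.eq_zero
  obtain rfl := ha.eq_zero
  refine eq_zero_of_forall_test fun φ hφ => ?_
  refine ext_inner_left ℂ fun c => ?_
  have hφ' : IsTest (fun x => star (φ x)) := by
    refine ⟨Complex.conjCLE.contDiff.comp hφ.1, ?_, ?_⟩
    · exact hφ.2.1.comp_left (g := fun z : ℂ => star z) (star_zero ℂ)
    · exact (closure_mono (Function.support_comp_subset (g := fun z : ℂ => star z)
        (star_zero ℂ) φ)).trans hφ.2.2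
  have hD : (hφ'.memLp c).toLp _ ∈ formDomain M θ := by
    refine ⟨⟨_, hφ'.hasWeakDeriv c⟩, fun j _ => ?_⟩
    have : component Mᴴ j ((hφ'.memLp c).toLp _) =
        (hφ'.memLp (Matrix.toEuclideanCLM (𝕜 := ℂ) Mᴴ c j)).toLp _ := by
      refine Lp.ext ?_
      refine (ContinuousLinearMap.coeFn_compLpL _ _).trans ?_
      filter_upwards [(hφ'.memLp c).coeFn_toLp,
        (hφ'.memLp (Matrix.toEuclideanCLM (𝕜 := ℂ) Mᴴ c j)).coeFn_toLp] with x h1 h2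
      rw [h1, h2, map_smul]
      rfl
    rw [this]
    exact hφ'.mem_H10 _
  obtain ⟨-, hf⟩ := h _ hD _ _ (hφ'.hasWeakDeriv c) (hφ'.hasBoundaryValue c)
  have e : ∫ x in Ioi (0 : ℝ), (inner ℂ ((hφ'.memLp c).toLp _ x)
      (Matrix.toEuclideanCLM (𝕜 := ℂ) (V x) ((0 : L2 (Cn n)) x)) : ℂ) = 0 := by
    refine integral_eq_zero_of_ae ?_
    filter_upwards [Lp.coeFn_zero (Cn n) 2 halfLine] with x hx
    rw [hx, Pi.zero_apply, map_zero, inner_zero_right, Pi.zero_apply]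
  rw [formValue, e, map_zero, inner_zero_right, inner_zero_right, sub_zero, add_zero,
    L2.inner_def] at hf
  rw [inner_zero_right, ← integral_inner
    (integrable_test_smul hφ.1.continuous hφ.2.1 w), hf]
  refine integral_congr_ae ?_
  filter_upwards [(hφ'.memLp c).coeFn_toLp] with x hx
  rw [hx, inner_smul_right, inner_smul_left]
  simp

/-- The operator `H_{A,B}` associated with the form `h_{A,B}`, where `(A, B)` is represented
by `M` and `θ`. -/
def hamiltonian (V : ℝ → Matrix (Fin n) (Fin n) ℂ) (M : Matrix (Fin n) (Fin n) ℂ)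
    (θ : Fin n → ℝ) : L2 (Cn n) →ₗ.[ℂ] L2 (Cn n) :=
  (hamiltonianGraph V M θ).toLinearPMap

theorem hamiltonian_graph (V : ℝ → Matrix (Fin n) (Fin n) ℂ) (M : Matrix (Fin n) (Fin n) ℂ)
    (θ : Fin n → ℝ) : (hamiltonian V M θ).graph = hamiltonianGraph V M θ :=
  Submodule.toLinearPMap_graph_eq _ (hamiltonianGraph_functional V M θ)

/-! ### Resolvents -/

section Resolvent

variable {X : Type*} [NormedAddCommGroup X] [NormedSpace ℂ X]

/-- `D - z` is a bijection from the domain of `D` onto the whole space, with inverse the bounded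
operator `R`. -/
def IsResolventAt (D : X →ₗ.[ℂ] X) (z : ℂ) (R : X →L[ℂ] X) : Prop :=
  (∀ f : X, ∃ h : R f ∈ D.domain, D ⟨R f, h⟩ - z • R f = f) ∧
    ∀ u : D.domain, R (D u - z • (u : X)) = u

/-- The resolvent set `ρ(D)`. -/
def resolventSet (D : X →ₗ.[ℂ] X) : Set ℂ := {z | ∃ R : X →L[ℂ] X, IsResolventAt D z R}

open Classical in
/-- The resolvent `(D - z)⁻¹`, for `z` in the resolvent set. -/
def resolvent (D : X →ₗ.[ℂ] X) (z : ℂ) : X →L[ℂ] X :=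
  if h : z ∈ resolventSet D then h.choose else 0

theorem resolvent_spec {D : X →ₗ.[ℂ] X} {z : ℂ} (h : z ∈ resolventSet D) :
    IsResolventAt D z (resolvent D z) := by
  rw [resolvent, dif_pos h]
  exact h.choose_spec

theorem IsResolventAt.unique {D : X →ₗ.[ℂ] X} {z : ℂ} {R S : X →L[ℂ] X}
    (hR : IsResolventAt D z R) (hS : IsResolventAt D z S) : R = S := by
  ext f
  obtain ⟨h, hf⟩ := hS.1 f
  have := hR.2 ⟨S f, h⟩
  rwa [hf] at this

end Resolvent

/-! ### The trace norm -/

section TraceNorm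

variable {X : Type*} [NormedAddCommGroup X] [InnerProductSpace ℂ X] [CompleteSpace X]

/-- The trace norm `‖T‖₁ = Tr |T| = ∑ᵢ (|T| eᵢ, eᵢ)`, where `|T| = (T* T)^{1/2}` and `(eᵢ)` is a
Hilbert basis; the sum is the same for all Hilbert bases, so the supremum is its value. -/
def traceNorm (T : X →L[ℂ] X) : ℝ≥0∞ :=
  ⨆ (s : Set X) (e : HilbertBasis s ℂ X),
    ∑' i : s, ENNReal.ofReal (RCLike.re (inner ℂ (CFC.abs T (e i)) (e i)))

/-- `T` is trace class. -/
def IsTraceClass (T : X →L[ℂ] X) : Prop := traceNorm T < ⊤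

end TraceNorm

/-! ### The quantities in the bound -/

/-- The square root of `z` with nonnegative imaginary part. -/
def upperSqrt (z : ℂ) : ℂ :=
  if 0 ≤ (z ^ (1 / 2 : ℂ)).im then z ^ (1 / 2 : ℂ) else -z ^ (1 / 2 : ℂ)

theorem upperSqrt_sq (z : ℂ) : upperSqrt z ^ 2 = z := by
  have h : (z ^ (1 / 2 : ℂ)) ^ 2 = z := by
    rw [one_div]
    exact_mod_cast Complex.cpow_nat_inv_pow z two_ne_zero
  unfold upperSqrt
  split_ifs
  · exact h
  · rw [neg_sq, h]

theorem upperSqrt_im_nonneg (z : ℂ) : 0 ≤ (upperSqrt z).im := by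
  unfold upperSqrt
  split_ifs with h
  · exact h
  · rw [Complex.neg_im]
    linarith

/-- `|cos t + i k sin t|`. -/
def jostModulus (k : ℂ) (t : ℝ) : ℝ :=
  ‖(Real.cos t : ℂ) + Complex.I * k * (Real.sin t : ℂ)‖

open Classical in
/-- `D(k)`: the maximum of `1 / |k|` and of the numbers `1 / |cos θ_j + i k sin θ_j|`, over the
mixed angles `θ_j`. -/
def boundD (θ : Fin n → ℝ) (k : ℂ) : ℝ :=
  (Finset.univ.filter fun j => IsMixed (θ j)).fold max (1 / ‖k‖)
    fun j => 1 / jostModulus k (θ j)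

open Classical in
/-- `F(k)`: the maximum of the numbers `(1 + |k|) / |cos θ_j + i k sin θ_j|`, over the mixed angles
`θ_j`, and of `1`. Each of these numbers is at least `1`, so that the `1` only matters if there is
no mixed angle. -/
def boundF (θ : Fin n → ℝ) (k : ℂ) : ℝ :=
  (Finset.univ.filter fun j => IsMixed (θ j)).fold max 1
    fun j => (1 + ‖k‖) / jostModulus k (θ j)

end HalfLine

end

/-! Part (a). The hypotheses give `(A + iB)† (A + iB) = A†A + B†B`, so `det (A + zB)` is not the
zero polynomial and some real `t` makes `P = A + tB` invertible. With `Q = B - tA` the matrix `Q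
P⁻¹` is Hermitian. Its unitary diagonalization `M`, with eigenvalues `λ_j`, diagonalizes `A P⁻¹` and
`B P⁻¹` simultaneously, and each pair of diagonal entries is a real nonzero vector, hence `ρ_j (-sin
θ_j, cos θ_j)` with `ρ_j ≠ 0`.

Parts (c) and (d). Put `k = √z`. The two free resolvents applied to the same `f` differ by an `L²`
solution of `-w'' = k² w`, that is by `e^{ikx} a`. The boundary condition, diagonal in the columns
of `M`, gives `a` in terms of the value at `0` of the Neumann solution, and that value is the
pairing of `f` with an exponential. The difference is thus the explicit operator of rank at most `n`
in `resolvent_sub_resolvent_apply`, with coefficients `-(i/k) cos θ_j / (cos θ_j + i k sin θ_j)` and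
exponentials of squared norm `1 / (2 Im k)`. Here `Im k > 0` because the Neumann spectrum contains
`[0, ∞)` (`upperSqrt_im_pos`), and no denominator vanishes because its zeros are eigenvalues
(`IsDiagonalRepr.jost_ne_zero`).

Part (b). Inserting `R f` and `R₀* g` into the form gives the weak resolvent identity `⟨g, (R - R₀)
f⟩ = -∫ ⟨R₀* g, V R f⟩` (`IsDiagonalRepr.inner_resolvent_sub`). Both `R` and `R₀*` map into the
first Sobolev space, where point evaluation is bounded. Bessel's inequality then bounds `∑ ‖(R
e_i)(x)‖²` uniformly in `x` for orthonormal `e_i` (`SmoothingBound.ae_sum_norm_sq_le`), and likewise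
for `R₀*`. Integrating against `‖V(x)‖` bounds `∑ |⟨W e_i, (R - R₀) e_i⟩|` for every contraction
`W`, which controls the trace norm by polar decomposition (`traceNorm_le_of_forall_sum_le`).

The analytic basis is that an `L²` function with weak derivative in `L²` is the primitive of that
derivative, vanishes at infinity in the sense needed for integration by parts, and lies in `H10`
exactly when its boundary value is `0`. -/

noncomputable section

namespace HalfLine

/-! ### Integration by parts for primitives of integrable functions. -/

section Primitives

variable {E : Type*} [NormedAddCommGroup E] [InnerProductSpace ℂ E] [CompleteSpace E]

theorem integral_inner_const {α : Type*} {m : MeasurableSpace α} {μ : Measure α} {F : α → E}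
    (hF : Integrable F μ) (c : E) :
    ∫ x, inner ℂ (F x) c ∂μ = inner ℂ (∫ x, F x ∂μ) c := by
  rw [← inner_conj_symm, ← integral_inner hF, ← integral_conj]
  exact integral_congr_ae (Filter.Eventually.of_forall fun x => (inner_conj_symm _ _).symm)

/-- Integration by parts for primitives that vanish at `a`. -/
theorem integral_inner_primitive {F G : ℝ → E} {a b : ℝ}
    (hF : IntegrableOn F (Ioc a b)) (hG : IntegrableOn G (Ioc a b)) :
    (∫ s in Ioc a b, inner ℂ (F s) (∫ t in Ioc a s, G t)) +
      (∫ s in Ioc a b, inner ℂ (∫ t in Ioc a s, F t) (G s)) =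
      (inner ℂ (∫ s in Ioc a b, F s) (∫ s in Ioc a b, G s) : ℂ) := by
  set μ := volume.restrict (Ioc a b) with hμ
  let H : ℝ × ℝ → ℂ := fun p => inner ℂ (F p.1) (G p.2)
  have hH : Integrable H (μ.prod μ) := by
    refine Integrable.op_fst_snd (op := fun x y : E => (inner ℂ x y : ℂ)) ?_ ?_ hF hG
    · exact continuous_inner
    · exact ⟨1, fun x y => by simpa using norm_inner_le_norm x y⟩
  -- Fubini on the square `(a, b]²`: the diagonal splits the integral of `⟨F s, G t⟩` into two
  -- triangles, one for each term on the left.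
  have hD : MeasurableSet {p : ℝ × ℝ | p.2 ≤ p.1} :=
    measurableSet_le measurable_snd measurable_fst
  have h1 : ∫ p in {p : ℝ × ℝ | p.2 ≤ p.1}, H p ∂(μ.prod μ)
      = ∫ s, inner ℂ (F s) (∫ t in Ioc a s, G t) ∂μ := by
    rw [← integral_indicator hD, integral_prod _ (hH.indicator hD)]
    refine setIntegral_congr_fun measurableSet_Ioc fun s hs => ?_
    have : (fun t => indicator {p : ℝ × ℝ | p.2 ≤ p.1} H (s, t))
        = indicator (Iic s) fun t => inner ℂ (F s) (G t) := by
      funext t; simp [indicator, H]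
    simp only [this]
    rw [integral_indicator measurableSet_Iic, hμ, Measure.restrict_restrict measurableSet_Iic]
    have e : Iic s ∩ Ioc a b = Ioc a s := by
      ext t; simp only [mem_inter_iff, mem_Iic, mem_Ioc]
      exact ⟨fun h => ⟨h.2.1, h.1⟩, fun h => ⟨h.2, h.1, h.2.trans hs.2⟩⟩
    rw [e, integral_inner (hG.mono_set (Ioc_subset_Ioc_right hs.2))]
  have h2 : ∫ p in {p : ℝ × ℝ | p.2 ≤ p.1}ᶜ, H p ∂(μ.prod μ)
      = ∫ s, inner ℂ (∫ t in Ioc a s, F t) (G s) ∂μ := by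
    rw [← integral_indicator hD.compl, integral_prod_symm _ (hH.indicator hD.compl)]
    refine setIntegral_congr_fun measurableSet_Ioc fun s hs => ?_
    have : (fun t => indicator {p : ℝ × ℝ | p.2 ≤ p.1}ᶜ H (t, s))
        = indicator (Iio s) fun t => inner ℂ (F t) (G s) := by
      funext t; simp [indicator, H]
    simp only [this]
    rw [integral_indicator measurableSet_Iio, hμ, Measure.restrict_restrict measurableSet_Iio]
    have e : Iio s ∩ Ioc a b = Ioo a s := by
      ext t; simp only [mem_inter_iff, mem_Iio, mem_Ioc, mem_Ioo]
      exact ⟨fun h => ⟨h.2.1, h.1⟩, fun h => ⟨h.2, h.1, h.2.le.trans hs.2⟩⟩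
    rw [e, ← integral_Ioc_eq_integral_Ioo,
      integral_inner_const (hF.mono_set (Ioc_subset_Ioc_right hs.2))]
  rw [← h1, ← h2, integral_add_compl hD hH, integral_prod _ hH]
  simp only [H]
  have : ∀ s, ∫ t, inner ℂ (F s) (G t) ∂μ = inner ℂ (F s) (∫ t, G t ∂μ) := fun s =>
    integral_inner hG _
  simp only [this]
  exact integral_inner_const hF _

/-- Integration by parts on `(a, b]` for primitives of integrable functions. -/
theorem inner_sub_inner_eq_integral {F G u v : ℝ → E} {a b : ℝ} (hab : a ≤ b)
    (hF : IntegrableOn F (Ioc a b)) (hG : IntegrableOn G (Ioc a b))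
    (hu : ∀ x ∈ Icc a b, u x = u a + ∫ t in Ioc a x, F t)
    (hv : ∀ x ∈ Icc a b, v x = v a + ∫ t in Ioc a x, G t)
    (hFv : IntegrableOn (fun x => (inner ℂ (F x) (v x) : ℂ)) (Ioc a b))
    (huG : IntegrableOn (fun x => (inner ℂ (u x) (G x) : ℂ)) (Ioc a b)) :
    (inner ℂ (u b) (v b) - inner ℂ (u a) (v a) : ℂ) =
      ∫ x in Ioc a b, (inner ℂ (F x) (v x) + inner ℂ (u x) (G x)) := by
  have hFc : IntegrableOn (fun x => (inner ℂ (F x) (v a) : ℂ)) (Ioc a b) := hF.inner_const _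
  have hGc : IntegrableOn (fun x => (inner ℂ (u a) (G x) : ℂ)) (Ioc a b) := hG.const_inner _
  have e1 : ∫ x in Ioc a b, (inner ℂ (F x) (v x) : ℂ) = inner ℂ (∫ x in Ioc a b, F x) (v a) +
      ∫ s in Ioc a b, inner ℂ (F s) (∫ t in Ioc a s, G t) := by
    rw [← integral_inner_const hF, ← integral_add hFc]
    · refine setIntegral_congr_fun measurableSet_Ioc fun s hs => ?_
      rw [← inner_add_right, ← hv s (Ioc_subset_Icc_self hs)]
    · refine (hFv.sub hFc).congr_fun (fun s hs => ?_) measurableSet_Ioc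
      simp only [Pi.sub_apply]
      rw [hv s (Ioc_subset_Icc_self hs), inner_add_right, add_sub_cancel_left]
  have e2 : ∫ x in Ioc a b, (inner ℂ (u x) (G x) : ℂ) = inner ℂ (u a) (∫ x in Ioc a b, G x) +
      ∫ s in Ioc a b, inner ℂ (∫ t in Ioc a s, F t) (G s) := by
    rw [← integral_inner hG, ← integral_add hGc]
    · refine setIntegral_congr_fun measurableSet_Ioc fun s hs => ?_
      rw [← inner_add_left, ← hu s (Ioc_subset_Icc_self hs)]
    · refine (huG.sub hGc).congr_fun (fun s hs => ?_) measurableSet_Ioc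
      simp only [Pi.sub_apply]
      rw [hu s (Ioc_subset_Icc_self hs), inner_add_left, add_sub_cancel_left]
  rw [integral_add hFv huG, e1, e2, hu b (right_mem_Icc.mpr hab), hv b (right_mem_Icc.mpr hab)]
  simp only [inner_add_left, inner_add_right]
  rw [← integral_inner_primitive hF hG]
  ring

end Primitives

/-! ### Continuous representatives and primitives of `L²` functions. -/

section Representatives

variable {E : Type*} [NormedAddCommGroup E] [InnerProductSpace ℂ E] [CompleteSpace E]

theorem IsTest.conj {φ : ℝ → ℂ} (h : IsTest φ) : IsTest fun x => star (φ x) :=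
  ⟨Complex.conjCLE.contDiff.comp h.1,
    h.2.1.comp_left (g := fun z : ℂ => star z) (star_zero ℂ),
    (closure_mono (Function.support_comp_subset (g := fun z : ℂ => star z)
      (star_zero ℂ) φ)).trans h.2.2⟩

theorem IsTest.hasDerivAt {φ : ℝ → ℂ} (h : IsTest φ) (x : ℝ) : HasDerivAt φ (deriv φ x) x :=
  (h.1.differentiable (by simp) x).hasDerivAt

theorem deriv_star (φ : ℝ → ℂ) : deriv (fun x => star (φ x)) = fun x => star (deriv φ x) := by
  funext x
  exact deriv.star (f := φ) (x := x)

/-- The support of a test function lies in a compact interval of `(0, ∞)`. -/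
theorem IsTest.exists_Icc {φ : ℝ → ℂ} (h : IsTest φ) :
    ∃ a b : ℝ, 0 < a ∧ a ≤ b ∧ tsupport φ ⊆ Icc a b := by
  rcases (tsupport φ).eq_empty_or_nonempty with h0 | h0
  · exact ⟨1, 1, one_pos, le_rfl, by simp [h0]⟩
  · obtain ⟨a, ha⟩ := h.2.1.isCompact.exists_isLeast h0
    obtain ⟨b, hb⟩ := h.2.1.isCompact.exists_isGreatest h0
    exact ⟨a, b, h.2.2 ha.1, ha.2 hb.1, fun x hx => ⟨ha.2 hx, hb.2 hx⟩⟩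

omit [InnerProductSpace ℂ E] [CompleteSpace E] in
theorem integrableOn_Ioc_coe (f : L2 E) {a : ℝ} (ha : 0 ≤ a) (b : ℝ) :
    IntegrableOn f (Ioc a b) := by
  have h : MemLp f 2 (volume.restrict (Ioc a b)) :=
    (Lp.memLp f).mono_measure (Measure.restrict_mono (fun x hx => ha.trans_lt hx.1) le_rfl)
  exact h.integrable (by norm_num)

/-- `u` is the primitive of `f'`, continuous on `[0, ∞)`, that represents `f`. -/
structure IsPrimitiveRep (f f' : L2 E) (u : ℝ → E) : Prop where
  ae_eq : f =ᵐ[halfLine] u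
  continuousOn : ContinuousOn u (Ici 0)
  eq_add_integral : ∀ a b : ℝ, 0 ≤ a → a ≤ b → u b = u a + ∫ t in Ioc a b, f' t

omit [CompleteSpace E] in
theorem continuousOn_integral_Ioc (g : L2 E) :
    ContinuousOn (fun x => ∫ t in Ioc 0 x, g t) (Ici 0) := by
  intro x hx
  have h1 : ContinuousOn (fun x => ∫ t in Ioc 0 x, g t) (Icc 0 (x + 1)) :=
    intervalIntegral.continuousOn_primitive
      ((integrableOn_Icc_iff_integrableOn_Ioc).mpr (integrableOn_Ioc_coe g le_rfl _))
  refine (h1 x ⟨hx, by linarith⟩).mono_of_mem_nhdsWithin ?_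
  rw [← Ici_inter_Iic]
  exact inter_mem_nhdsWithin _ (Iic_mem_nhds (by linarith))

omit [CompleteSpace E] in
theorem integral_Ioc_eq_add (g : L2 E) {a b : ℝ} (ha : 0 ≤ a) (hab : a ≤ b) :
    ∫ t in Ioc 0 b, g t = (∫ t in Ioc 0 a, g t) + ∫ t in Ioc a b, g t := by
  rw [← Ioc_union_Ioc_eq_Ioc ha hab, setIntegral_union (Ioc_disjoint_Ioc_of_le le_rfl)
    measurableSet_Ioc (integrableOn_Ioc_coe g le_rfl _) (integrableOn_Ioc_coe g ha _)]

omit [CompleteSpace E] in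
theorem integrableOn_inner_of_continuousOn {F v : ℝ → E} {a b : ℝ}
    (hF : IntegrableOn F (Ioc a b)) (hv : ContinuousOn v (Icc a b)) :
    IntegrableOn (fun x => (inner ℂ (F x) (v x) : ℂ)) (Ioc a b) := by
  obtain ⟨C, hC⟩ := isCompact_Icc.exists_bound_of_continuousOn hv
  refine Integrable.mono' (hF.norm.mul_const C) (hF.1.inner
    ((hv.mono Ioc_subset_Icc_self).aestronglyMeasurable measurableSet_Ioc)) ?_
  filter_upwards [ae_restrict_mem measurableSet_Ioc] with x hx
  exact (norm_inner_le_norm _ _).trans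
    (mul_le_mul_of_nonneg_left (hC x (Ioc_subset_Icc_self hx)) (norm_nonneg _))

/-- Integration by parts on a bounded interval. -/
theorem inner_sub_inner_eq_integral_of_continuousOn {F G u v : ℝ → E} {a b : ℝ} (hab : a ≤ b)
    (hF : IntegrableOn F (Ioc a b)) (hG : IntegrableOn G (Ioc a b))
    (huc : ContinuousOn u (Icc a b)) (hvc : ContinuousOn v (Icc a b))
    (hu : ∀ x ∈ Icc a b, u x = u a + ∫ t in Ioc a x, F t)
    (hv : ∀ x ∈ Icc a b, v x = v a + ∫ t in Ioc a x, G t) :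
    (inner ℂ (u b) (v b) - inner ℂ (u a) (v a) : ℂ) =
      ∫ x in Ioc a b, (inner ℂ (F x) (v x) + inner ℂ (u x) (G x)) := by
  refine inner_sub_inner_eq_integral hab hF hG hu hv
    (integrableOn_inner_of_continuousOn hF hvc) ?_
  have := (integrableOn_inner_of_continuousOn hG huc).norm
  refine (integrable_norm_iff (((huc.mono Ioc_subset_Icc_self).aestronglyMeasurable
    measurableSet_Ioc).inner hG.1)).mp ?_
  simpa only [norm_inner_symm] using this

/-- A primitive of `g` has weak derivative `g`. -/
theorem integral_deriv_smul_primitive (g : L2 E) {φ : ℝ → ℂ} (hφ : IsTest φ) :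
    ∫ x in Ioi (0 : ℝ), deriv φ x • (∫ t in Ioc 0 x, g t) =
      - ∫ x in Ioi (0 : ℝ), φ x • g x := by
  obtain ⟨a, b', ha, hab, hs⟩ := hφ.exists_Icc
  -- The inequality is strict so that `φ b = 0`; as `φ 0 = 0` too, both boundary terms vanish.
  obtain ⟨b, hb'⟩ : ∃ b, b' < b := exists_gt b'
  have hb : 0 ≤ b := ha.le.trans (hab.trans hb'.le)
  have hsub : tsupport φ ⊆ Ioc 0 b := hs.trans fun x hx => ⟨ha.trans_le hx.1, hx.2.trans hb'.le⟩
  have hr (ψ : ℝ → ℂ) (hψ : tsupport ψ ⊆ tsupport φ) (F : ℝ → E) :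
      ∫ x in Ioi (0 : ℝ), ψ x • F x = ∫ x in Ioc 0 b, ψ x • F x := by
    refine setIntegral_eq_of_subset_of_forall_sdiff_eq_zero measurableSet_Ioi
      (fun x hx => hx.1) fun x hx => ?_
    rw [image_eq_zero_of_notMem_tsupport fun h => hx.2 (hsub (hψ h)), zero_smul]
  have hc : Continuous fun x => star (φ x) := hφ.conj.1.continuous
  have hc' : Continuous fun x => star (deriv φ x) := by
    rw [← deriv_star]; exact hφ.conj.continuous_deriv
  have hP : ContinuousOn (fun x => ∫ t in Ioc 0 x, g t) (Icc 0 b) :=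
    (continuousOn_integral_Ioc g).mono Icc_subset_Ici_self
  have hg := integrableOn_Ioc_coe g le_rfl b
  rw [hr _ tsupport_deriv_subset, hr _ subset_rfl, eq_neg_iff_add_eq_zero]
  have hi1 : IntegrableOn (fun x => deriv φ x • (∫ t in Ioc 0 x, g t)) (Ioc 0 b) :=
    ((hφ.continuous_deriv.continuousOn.smul hP).integrableOn_Icc).mono_set Ioc_subset_Icc_self
  have hi2 : IntegrableOn (fun x => φ x • g x) (Ioc 0 b) :=
    (integrable_test_smul hφ.1.continuous hφ.2.1 g).mono_measure
      (Measure.restrict_mono (fun x hx => hx.1) le_rfl)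
  rw [← integral_add hi1 hi2]
  refine ext_inner_left ℂ fun c => ?_
  rw [inner_zero_right]
  refine (integral_inner (hi1.add hi2) c).symm.trans ?_
  have hφb : φ b = 0 := image_eq_zero_of_notMem_tsupport fun h => (hs h).2.not_gt hb'
  have h0 : φ 0 = 0 := image_eq_zero_of_notMem_tsupport fun h => (hs h).1.not_gt ha
  -- The vector identity is tested against each `c`. The conjugate of `φ` appears because the inner
  -- product is conjugate linear in its first argument.
  have key := inner_sub_inner_eq_integral_of_continuousOn (F := fun x => star (deriv φ x) • c)
    (G := g) (u := fun x => star (φ x) • c) (v := fun x => ∫ t in Ioc 0 x, g t) hb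
    ((hc'.smul continuous_const).integrableOn_Ioc) hg
    (hc.smul continuous_const).continuousOn hP (fun x hx => ?_) (fun x hx => by simp)
  · refine Eq.trans (setIntegral_congr_fun measurableSet_Ioc fun x hx => ?_) (key.symm.trans ?_)
    · simp only [Pi.add_apply, inner_add_right, inner_smul_right, inner_smul_left, RCLike.star_def,
        RCLike.conj_conj]
    · simp [h0, hφb]
  · rw [h0, star_zero, zero_smul, zero_add, ← intervalIntegral.integral_of_le hx.1,
      intervalIntegral.integral_eq_sub_of_hasDerivAt (f := fun x => star (φ x) • c)]
    · simp [h0]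
    · intro y _
      have := (hφ.conj.hasDerivAt y).smul_const c
      rwa [deriv_star] at this
    · exact (hc'.smul continuous_const).intervalIntegrable _ _

end Representatives

/-! ### Weak derivatives, boundary values and integration by parts on the half line. -/

section WeakDerivatives

variable {E : Type*} [NormedAddCommGroup E] [InnerProductSpace ℂ E] [CompleteSpace E]

theorem exists_isTest_integral_eq_one : ∃ ψ : ℝ → ℂ, IsTest ψ ∧ ∫ x, ψ x = 1 := by
  let f : ContDiffBump (2 : ℝ) := ⟨1 / 2, 1, by norm_num, by norm_num⟩
  have hs : tsupport (fun x => (f.normed volume x : ℂ)) ⊆ tsupport (f.normed volume) :=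
    closure_mono (Function.support_comp_subset (g := fun r : ℝ => (r : ℂ))
        Complex.ofReal_zero (f.normed volume))
  refine ⟨fun x => (f.normed volume x : ℂ),
    ⟨Complex.ofRealCLM.contDiff.comp f.contDiff_normed,
      f.hasCompactSupport_normed.comp_left (g := fun r : ℝ => (r : ℂ)) Complex.ofReal_zero,
      hs.trans ?_⟩, ?_⟩
  · rw [f.tsupport_normed_eq, Real.closedBall_eq_Icc]
    intro x hx
    have : (2 : ℝ) - 1 ≤ x := hx.1
    exact mem_Ioi.mpr (by linarith)
  · rw [integral_complex_ofReal, f.integral_normed, Complex.ofReal_one]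

/-- A test function with integral zero is the derivative of a test function. -/
theorem IsTest.exists_deriv_eq {φ : ℝ → ℂ} (h : IsTest φ) (h0 : ∫ x, φ x = 0) :
    ∃ χ, IsTest χ ∧ deriv χ = φ := by
  obtain ⟨a, b, ha, hab, hs⟩ := h.exists_Icc
  have hc := h.1.continuous
  have hd : deriv (fun u => ∫ x in (0 : ℝ)..u, φ x) = φ := by
    funext x
    exact hc.deriv_integral φ 0 x
  have hz (x : ℝ) (hx : x ∉ Icc a b) : φ x = 0 :=
    image_eq_zero_of_notMem_tsupport fun hm => hx (hs hm)
  have hsupp : Function.support (fun u => ∫ x in (0 : ℝ)..u, φ x) ⊆ Icc a b := by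
    intro x hx
    by_contra hn
    refine hx ?_
    rcases lt_or_ge x a with hxa | hxa
    · refine intervalIntegral.integral_zero_ae (Filter.Eventually.of_forall fun y hy => hz y ?_)
      intro hy'
      rcases le_total 0 x with h | h
      · rw [uIoc_of_le h] at hy; exact absurd hy'.1 (hy.2.trans_lt hxa).not_ge
      · rw [uIoc_of_ge h] at hy; exact absurd hy'.1 (hy.2.trans_lt ha).not_ge
    · have hbx : b < x := lt_of_not_ge fun h => hn ⟨hxa, h⟩
      have h0x : 0 ≤ x := ha.le.trans hxa
      show ∫ y in (0 : ℝ)..x, φ y = 0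
      rw [intervalIntegral.integral_of_le h0x, ← h0]
      refine setIntegral_eq_integral_of_forall_compl_eq_zero fun y hy => hz y fun hy' => hy ?_
      exact ⟨ha.trans_le hy'.1, hy'.2.trans hbx.le⟩
  have hts : tsupport (fun u => ∫ x in (0 : ℝ)..u, φ x) ⊆ Icc a b :=
    closure_minimal hsupp isClosed_Icc
  refine ⟨_, ⟨contDiff_infty_iff_deriv.mpr ⟨fun x => ?_, by rw [hd]; exact h.1⟩,
    isCompact_Icc.of_isClosed_subset (isClosed_tsupport _) hts,
    hts.trans fun x hx => ha.trans_le hx.1⟩, hd⟩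
  exact (intervalIntegral.integral_hasDerivAt_right (hc.intervalIntegrable _ _)
    (hc.stronglyMeasurableAtFilter _ _) hc.continuousAt).differentiableAt

theorem integral_Ioi_isTest {φ : ℝ → ℂ} (h : IsTest φ) : ∫ x in Ioi (0 : ℝ), φ x = ∫ x, φ x :=
  setIntegral_eq_integral_of_forall_compl_eq_zero fun _ hx =>
    image_eq_zero_of_notMem_tsupport fun hm => hx (h.2.2 hm)

/-- A function in `L²` with a weak derivative in `L²` is the primitive of that derivative. -/
theorem HasWeakDeriv.exists_isPrimitiveRep {f f' : L2 E} (h : HasWeakDeriv f f') :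
    ∃ u : ℝ → E, IsPrimitiveRep f f' u := by
  obtain ⟨ψ, hψ, hψ1⟩ := exists_isTest_integral_eq_one
  set P : ℝ → E := fun x => ∫ t in Ioc 0 x, f' t with hP
  have hPc : ContinuousOn P (Ici 0) := continuousOn_integral_Ioc f'
  have hPi {φ : ℝ → ℂ} (hφ : IsTest φ) : Integrable (fun x => φ x • P x) halfLine := by
    obtain ⟨a, b, ha, hab, hs⟩ := hφ.exists_Icc
    have : IntegrableOn (fun x => φ x • P x) (Icc a b) :=
      (hφ.1.continuous.continuousOn.smul
        (hPc.mono fun x hx => ha.le.trans hx.1)).integrableOn_Icc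
    have h2 : Integrable (fun x => φ x • P x) := by
      refine (integrableOn_iff_integrable_of_support_subset fun x hx => ?_).mp this
      exact hs (subset_tsupport _ (Function.support_smul_subset_left _ _ hx))
    exact h2.restrict
  have hi {φ : ℝ → ℂ} (hφ : IsTest φ) : Integrable (fun x => φ x • (f x - P x)) halfLine := by
    simp only [smul_sub]
    exact (integrable_test_smul hφ.1.continuous hφ.2.1 f).sub (hPi hφ)
  -- The du Bois-Reymond argument: `f - P` annihilates all derivatives of test functions, which are
  -- the test functions of integral zero. Subtracting a multiple of `ψ` reduces any test function to
  -- this case, so `f - P` is the constant `c`.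
  have hd {φ : ℝ → ℂ} (hφ : IsTest φ) (h0 : ∫ x, φ x = 0) :
      ∫ x in Ioi (0 : ℝ), φ x • (f x - P x) = 0 := by
    obtain ⟨χ, hχ, rfl⟩ := hφ.exists_deriv_eq h0
    simp only [smul_sub]
    rw [integral_sub (integrable_test_smul hφ.1.continuous hφ.2.1 f) (hPi hφ), h χ hχ,
      integral_deriv_smul_primitive f' hχ, sub_self]
  set c : E := ∫ x in Ioi (0 : ℝ), ψ x • (f x - P x)
  have hc {φ : ℝ → ℂ} (hφ : IsTest φ) :
      ∫ x in Ioi (0 : ℝ), φ x • (f x - P x) = (∫ x, φ x) • c := by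
    set m := ∫ x, φ x
    have hsub : IsTest fun x => φ x - m * ψ x := by
      refine ⟨hφ.1.sub (contDiff_const.mul hψ.1), hφ.2.1.sub hψ.2.1.mul_left, ?_⟩
      refine (tsupport_sub _ _).trans (union_subset hφ.2.2 ?_)
      exact tsupport_mul_subset_right.trans hψ.2.2
    have h1 := hd hsub (by
      rw [integral_sub (hφ.1.continuous.integrable_of_hasCompactSupport hφ.2.1)
        ((hψ.1.continuous.integrable_of_hasCompactSupport hψ.2.1).const_mul m),
        integral_const_mul, hψ1, mul_one, sub_self])
    simp only [sub_smul, mul_smul] at h1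
    have hmi : Integrable (fun x => m • ψ x • (f x - P x)) halfLine := (hi hψ).smul m
    rwa [integral_sub (hi hφ) hmi, integral_smul, sub_eq_zero] at h1
  have hae : ∀ᵐ x ∂halfLine, x ∈ Ioi (0 : ℝ) → f x - P x - c = 0 := by
    refine isOpen_Ioi.ae_eq_zero_of_integral_contDiff_smul_eq_zero ?_ ?_
    · have h1 : LocallyIntegrable f halfLine := (Lp.memLp f).locallyIntegrable (by norm_num)
      have h2 : LocallyIntegrableOn P (Ioi 0) halfLine :=
        (hPc.mono Ioi_subset_Ici_self).locallyIntegrableOn measurableSet_Ioi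
      exact ((h1.locallyIntegrableOn _).sub h2).sub
        ((locallyIntegrable_const c).locallyIntegrableOn _)
    · intro φ hφ hφc hs
      have ht : IsTest (fun x => (φ x : ℂ)) := by
        refine ⟨Complex.ofRealCLM.contDiff.comp hφ,
          hφc.comp_left (g := fun r : ℝ => (r : ℂ)) Complex.ofReal_zero, ?_⟩
        exact (closure_mono (Function.support_comp_subset (g := fun r : ℝ => (r : ℂ))
          Complex.ofReal_zero φ)).trans hs
      have hφi : Integrable (fun x => (φ x : ℂ)) halfLine :=
        (ht.1.continuous.integrable_of_hasCompactSupport ht.2.1).restrict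
      simp only [smul_sub _ _ c, ← Complex.coe_smul (φ _)]
      rw [integral_sub (hi ht) (hφi.smul_const c), hc ht, integral_smul_const,
        integral_Ioi_isTest ht, sub_self]
  refine ⟨fun x => c + P x, ?_, continuousOn_const.add hPc, fun a b ha hab => ?_⟩
  · filter_upwards [hae, ae_restrict_mem measurableSet_Ioi] with x hx hx0
    have := hx hx0
    rw [sub_sub, sub_eq_zero] at this
    rw [this, add_comm]
  · simp only [hP, integral_Ioc_eq_add f' ha hab, add_assoc]

omit [InnerProductSpace ℂ E] [CompleteSpace E] in
theorem eqOn_of_ae_eq_halfLine {u v : ℝ → E} (h : u =ᵐ[halfLine] v)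
    (hu : ContinuousOn u (Ici 0)) (hv : ContinuousOn v (Ici 0)) : EqOn u v (Ici 0) :=
  EqOn.of_subset_closure (s := Ioi 0)
    (Measure.eqOn_of_ae_eq h (hu.mono Ioi_subset_Ici_self) (hv.mono Ioi_subset_Ici_self)
      (by rw [isOpen_Ioi.interior_eq]; exact subset_closure))
    hu hv Ioi_subset_Ici_self (by rw [closure_Ioi])

omit [InnerProductSpace ℂ E] [CompleteSpace E] in
theorem HasBoundaryValue.eq_of_continuousOn {f : L2 E} {a : E} (h : HasBoundaryValue f a)
    {u : ℝ → E} (hfu : f =ᵐ[halfLine] u) (hu : ContinuousOn u (Ici 0)) : a = u 0 := by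
  obtain ⟨v, hv, hfv, rfl⟩ := h
  exact eqOn_of_ae_eq_halfLine (hfv.symm.trans hfu) hv hu (mem_Ici.mpr le_rfl)

omit [InnerProductSpace ℂ E] [CompleteSpace E] in
theorem HasBoundaryValue.unique {f : L2 E} {a b : E} (ha : HasBoundaryValue f a)
    (hb : HasBoundaryValue f b) : a = b := by
  obtain ⟨v, hv, hfv, rfl⟩ := hb
  exact ha.eq_of_continuousOn hfv hv

theorem HasWeakDeriv.exists_hasBoundaryValue {f f' : L2 E} (h : HasWeakDeriv f f') :
    ∃ a, HasBoundaryValue f a := by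
  obtain ⟨u, hu⟩ := h.exists_isPrimitiveRep
  exact ⟨u 0, u, hu.continuousOn, hu.ae_eq, rfl⟩

/-- Integration by parts on `(x, ∞)`. -/
theorem IsPrimitiveRep.integral_Ioi {f f' g g' : L2 E} {u v : ℝ → E}
    (hu : IsPrimitiveRep f f' u) (hv : IsPrimitiveRep g g' v) {x : ℝ} (hx : 0 ≤ x) :
    ∫ t in Ioi x, ((inner ℂ (f' t) (g t) : ℂ) + inner ℂ (f t) (g' t)) =
      - inner ℂ (u x) (v x) := by
  set k : ℝ → ℂ := fun t => inner ℂ (f' t) (g t) + inner ℂ (f t) (g' t) with hk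
  have hki : IntegrableOn k (Ioi 0) := (L2.integrable_inner f' g).add (L2.integrable_inner f g')
  have hq (b : ℝ) (hb : x ≤ b) :
      (inner ℂ (u b) (v b) : ℂ) = inner ℂ (u x) (v x) + ∫ t in x..b, k t := by
    have hsub : Ioc x b ⊆ Ioi 0 := fun t ht => hx.trans_lt ht.1
    have := inner_sub_inner_eq_integral_of_continuousOn hb (integrableOn_Ioc_coe f' hx b)
      (integrableOn_Ioc_coe g' hx b)
      (hu.continuousOn.mono fun t ht => hx.trans ht.1)
      (hv.continuousOn.mono fun t ht => hx.trans ht.1)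
      (fun t ht => hu.eq_add_integral x t hx ht.1) (fun t ht => hv.eq_add_integral x t hx ht.1)
    rw [← sub_eq_iff_eq_add', this, intervalIntegral.integral_of_le hb]
    refine integral_congr_ae ?_
    filter_upwards [ae_restrict_of_ae_restrict_of_subset hsub hu.ae_eq,
      ae_restrict_of_ae_restrict_of_subset hsub hv.ae_eq] with t h1 h2
    simp only [hk, h1, h2]
  have hlim : Filter.Tendsto (fun b => (inner ℂ (u b) (v b) : ℂ)) Filter.atTop
      (nhds (inner ℂ (u x) (v x) + ∫ t in Ioi x, k t)) := by
    have := (intervalIntegral_tendsto_integral_Ioi x (hki.mono_set (Ioi_subset_Ioi hx))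
      Filter.tendsto_id).const_add (inner ℂ (u x) (v x))
    refine this.congr' ?_
    filter_upwards [Filter.eventually_ge_atTop x] with b hb
    exact (hq b hb).symm
  have hint : IntegrableOn (fun b => (inner ℂ (u b) (v b) : ℂ)) (Ioi 0) := by
    refine (L2.integrable_inner f g).congr ?_
    filter_upwards [hu.ae_eq, hv.ae_eq] with t h1 h2
    rw [h1, h2]
  -- `⟨u b, v b⟩` converges as `b → ∞` and is integrable over a set of infinite measure, so its
  -- limit is zero.
  have h0 := IntegrableAtFilter.eq_zero_of_tendsto (μ := volume) (l := Filter.atTop)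
    ⟨Ioi 0, Filter.Ioi_mem_atTop 0, hint⟩ (fun s hs => ?_) hlim
  · exact eq_neg_of_add_eq_zero_right h0
  · obtain ⟨b, hb⟩ := Filter.mem_atTop_sets.mp hs
    exact measure_mono_top (fun t ht => hb t ht) Real.volume_Ici

/-- Integration by parts on the half line. -/
theorem HasWeakDeriv.inner_add_inner {f f' g g' : L2 E} (hf : HasWeakDeriv f f')
    (hg : HasWeakDeriv g g') {a b : E} (ha : HasBoundaryValue f a) (hb : HasBoundaryValue g b) :
    (inner ℂ f' g + inner ℂ f g' : ℂ) = - inner ℂ a b := by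
  obtain ⟨u, hu⟩ := hf.exists_isPrimitiveRep
  obtain ⟨v, hv⟩ := hg.exists_isPrimitiveRep
  rw [ha.eq_of_continuousOn hu.ae_eq hu.continuousOn,
    hb.eq_of_continuousOn hv.ae_eq hv.continuousOn, ← hu.integral_Ioi hv le_rfl,
    integral_add (L2.integrable_inner f' g) (L2.integrable_inner f g'), L2.inner_def, L2.inner_def]

/-- The pointwise bound for functions in the first Sobolev space. -/
theorem HasWeakDeriv.norm_sq_le {f f' : L2 E} (hf : HasWeakDeriv f f') {u : ℝ → E}
    (hfu : f =ᵐ[halfLine] u) (hu : ContinuousOn u (Ici 0)) {x : ℝ} (hx : 0 ≤ x) :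
    ‖u x‖ ^ 2 ≤ 2 * (‖f‖ * ‖f'‖) := by
  obtain ⟨w, hw⟩ := hf.exists_isPrimitiveRep
  have hwx : u x = w x :=
    eqOn_of_ae_eq_halfLine (hfu.symm.trans hw.ae_eq) hu hw.continuousOn hx
  have hi : IntegrableOn (fun t => ‖f t‖ * ‖f' t‖) (Ioi 0) :=
    MemLp.integrable_mul (p := 2) (q := 2) (Lp.memLp f).norm (Lp.memLp f').norm
  -- `‖u x‖²` is minus the integral of the derivative of `‖u‖²` over `(x, ∞)`; Cauchy–Schwarz
  -- finishes.
  have h1 : ‖u x‖ ^ 2 ≤ ∫ t in Ioi x, 2 * (‖f t‖ * ‖f' t‖) := by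
    have h := hw.integral_Ioi hw hx
    rw [← hwx] at h
    have : ‖u x‖ ^ 2 = ‖- (inner ℂ (u x) (u x) : ℂ)‖ := by
      rw [norm_neg, inner_self_eq_norm_sq_to_K]; simp
    rw [this, ← h]
    refine norm_integral_le_of_norm_le ((hi.mono_set (Ioi_subset_Ioi hx)).const_mul 2)
      (Filter.Eventually.of_forall fun t => (norm_add_le _ _).trans ?_)
    have h3 := norm_inner_le_norm (𝕜 := ℂ) (f' t) (f t)
    have h4 := norm_inner_le_norm (𝕜 := ℂ) (f t) (f' t)
    linarith
  refine h1.trans ?_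
  rw [integral_const_mul]
  refine mul_le_mul_of_nonneg_left ?_ (by norm_num)
  refine (setIntegral_mono_set hi (Filter.Eventually.of_forall fun t => by positivity)
    (Ioi_subset_Ioi hx).eventuallyLE).trans ?_
  have h5 := integral_mul_le_Lp_mul_Lq_of_nonneg (μ := halfLine) (f := fun t => ‖f t‖)
    (g := fun t => ‖f' t‖) Real.HolderConjugate.two_two
    (Filter.Eventually.of_forall fun t => norm_nonneg _)
    (Filter.Eventually.of_forall fun t => norm_nonneg _)
    (by simpa using (Lp.memLp f).norm) (by simpa using (Lp.memLp f').norm)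
  refine h5.trans_eq ?_
  have hn (g : L2 E) : (∫ a in Ioi (0 : ℝ), ‖g a‖ ^ (2 : ℝ)) ^ (1 / (2 : ℝ)) = ‖g‖ := by
    have : ‖g‖ ^ 2 = ∫ a in Ioi (0 : ℝ), ‖g a‖ ^ (2 : ℝ) := by
      have h6 := L2.inner_def (𝕜 := ℂ) g g
      have h7 : ∀ a, (inner ℂ (g a) (g a) : ℂ) = ((‖g a‖ ^ (2 : ℝ) : ℝ) : ℂ) := fun a => by
        rw [inner_self_eq_norm_sq_to_K]; simp
      simp only [h7] at h6
      rw [inner_self_eq_norm_sq_to_K, integral_complex_ofReal] at h6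
      exact Complex.ofReal_injective ((Complex.ofReal_pow _ _).trans h6)
    rw [← this, ← Real.sqrt_eq_rpow, Real.sqrt_sq (norm_nonneg _)]
  rw [hn, hn]

end WeakDerivatives

/-! ### Applying constant linear and antilinear maps pointwise. -/

section Composition

variable {E F : Type*} [NormedAddCommGroup E] [InnerProductSpace ℂ E] [CompleteSpace E]
  [NormedAddCommGroup F] [InnerProductSpace ℂ F] [CompleteSpace F]

omit [CompleteSpace E] [CompleteSpace F] in
theorem HasBoundaryValue.compLpL {σ : ℂ →+* ℂ} [RingHomIsometric σ] {f : L2 E} {a : E}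
    (h : HasBoundaryValue f a) (L : E →SL[σ] F) :
    HasBoundaryValue (L.compLpL 2 halfLine f) (L a) := by
  obtain ⟨u, hu, hfu, rfl⟩ := h
  refine ⟨fun x => L (u x), L.continuous.comp_continuousOn hu, ?_, rfl⟩
  filter_upwards [L.coeFn_compLpL (p := 2) (μ := halfLine) f, hfu] with x h1 h2
  rw [h1, h2]

theorem HasWeakDeriv.compLpL {f f' : L2 E} (h : HasWeakDeriv f f') (L : E →L[ℂ] F) :
    HasWeakDeriv (L.compLpL 2 halfLine f) (L.compLpL 2 halfLine f') := by
  have key {φ : ℝ → ℂ} (hc : Continuous φ) (hs : HasCompactSupport φ) (g : L2 E) :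
      ∫ x in Ioi (0 : ℝ), φ x • L.compLpL 2 halfLine g x = L (∫ x in Ioi (0 : ℝ), φ x • g x) := by
    rw [← L.integral_comp_comm (integrable_test_smul hc hs g)]
    refine integral_congr_ae ?_
    filter_upwards [L.coeFn_compLpL (p := 2) (μ := halfLine) g] with x hx
    rw [hx, map_smul]
  intro φ hφ
  rw [key hφ.continuous_deriv hφ.2.1.deriv, key hφ.1.continuous hφ.2.1, h φ hφ, map_neg]

theorem HasWeakDeriv.compLpL_conj {f f' : L2 E} (h : HasWeakDeriv f f') (L : E →L⋆[ℂ] F) :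
    HasWeakDeriv (L.compLpL 2 halfLine f) (L.compLpL 2 halfLine f') := by
  -- An antilinear map is real linear, which is enough to commute with the integral; the test
  -- function is conjugated in passing.
  let Lr : E →L[ℝ] F :=
    { toFun := L
      map_add' := map_add L
      map_smul' := fun r x => by
        rw [← Complex.coe_smul, map_smulₛₗ, Complex.conj_ofReal, Complex.coe_smul]; rfl
      cont := L.continuous }
  have key {φ : ℝ → ℂ} (hc : Continuous φ) (hs : HasCompactSupport φ) (g : L2 E) :
      ∫ x in Ioi (0 : ℝ), star (φ x) • L.compLpL 2 halfLine g x =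
        L (∫ x in Ioi (0 : ℝ), φ x • g x) := by
    refine Eq.trans ?_ (Lr.integral_comp_comm (integrable_test_smul hc hs g))
    refine integral_congr_ae ?_
    filter_upwards [L.coeFn_compLpL (p := 2) (μ := halfLine) g] with x hx
    rw [hx]
    exact (map_smulₛₗ L (φ x) (g x)).symm
  intro φ hφ
  have h1 := key hφ.conj.continuous_deriv hφ.conj.2.1.deriv f
  have h2 := key hφ.conj.1.continuous hφ.conj.2.1 f'
  rw [h _ hφ.conj, map_neg, ← h2] at h1
  simpa only [deriv_star, star_star] using h1

end Composition

/-! ### `H_{1,0}` as the kernel of the boundary value. -/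

section VanishingBoundaryValue

/-- The test functions together with their derivatives, as a subspace of `L² × L²`. -/
def testPairs : Submodule ℂ (WithLp 2 (L2 ℂ × L2 ℂ)) where
  carrier := {p | ∃ φ : ℝ → ℂ, IsTest φ ∧ p.fst =ᵐ[halfLine] φ ∧ p.snd =ᵐ[halfLine] deriv φ}
  zero_mem' := by
    refine ⟨0, ⟨contDiff_const, HasCompactSupport.zero, by simp [tsupport]⟩, ?_, ?_⟩
    · exact Lp.coeFn_zero ℂ 2 halfLine
    · have : deriv (0 : ℝ → ℂ) = 0 := by funext x; simp
      rw [this]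
      exact Lp.coeFn_zero ℂ 2 halfLine
  add_mem' := by
    rintro p q ⟨φ, hφ, h1, h2⟩ ⟨ψ, hψ, h3, h4⟩
    refine ⟨φ + ψ, ⟨hφ.1.add hψ.1, hφ.2.1.add hψ.2.1,
      (tsupport_add φ ψ).trans (union_subset hφ.2.2 hψ.2.2)⟩, ?_, ?_⟩
    · exact (Lp.coeFn_add p.fst q.fst).trans (h1.add h3)
    · have : deriv (φ + ψ) = deriv φ + deriv ψ := by
        funext x; exact ((hφ.hasDerivAt x).add (hψ.hasDerivAt x)).deriv
      rw [this]
      exact (Lp.coeFn_add p.snd q.snd).trans (h2.add h4)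
  smul_mem' := by
    rintro c p ⟨φ, hφ, h1, h2⟩
    have hsupp : tsupport (c • φ) ⊆ tsupport φ :=
      closure_mono (Function.support_const_smul_subset c φ)
    refine ⟨c • φ, ⟨hφ.1.const_smul c, hφ.2.1.mono' (subset_closure.trans hsupp),
      hsupp.trans hφ.2.2⟩, ?_, ?_⟩
    · exact (Lp.coeFn_smul c p.fst).trans (h1.const_smul c)
    · have : deriv (c • φ) = c • deriv φ := by
        funext x; exact ((hφ.hasDerivAt x).const_smul c).deriv
      rw [this]
      exact (Lp.coeFn_smul c p.snd).trans (h2.const_smul c)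

/-- Orthogonality of `(p₁, p₂)` to all `(φ, φ')` is, up to conjugating `φ`, the weak equation `p₂' =
p₁`. -/
theorem hasWeakDeriv_of_mem_orthogonal {p : WithLp 2 (L2 ℂ × L2 ℂ)} (hp : p ∈ testPairsᗮ) :
    HasWeakDeriv p.snd p.fst := by
  intro φ hφ
  have hφ' := hφ.conj
  have h := hp (WithLp.toLp 2 ((hφ'.memLp (1 : ℂ)).toLp _, (hφ'.memLp_deriv (1 : ℂ)).toLp _))
    ⟨_, hφ', by simpa using (hφ'.memLp (1 : ℂ)).coeFn_toLp,
      by simpa using (hφ'.memLp_deriv (1 : ℂ)).coeFn_toLp⟩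
  rw [WithLp.prod_inner_apply] at h
  simp only [L2.inner_def] at h
  rw [add_comm] at h
  refine Eq.trans ?_ ((eq_neg_of_add_eq_zero_left h).trans (congrArg _ ?_))
  · refine integral_congr_ae ?_
    filter_upwards [(hφ'.memLp_deriv (1 : ℂ)).coeFn_toLp] with x hx
    rw [hx, deriv_star]
    simp [mul_comm]
  · refine integral_congr_ae ?_
    filter_upwards [(hφ'.memLp (1 : ℂ)).coeFn_toLp] with x hx
    rw [hx]
    simp [mul_comm]

theorem norm_toLp_sub_lt {φ : ℝ → ℂ} {f : L2 ℂ} {ε : ℝ} (hφ : MemLp φ 2 halfLine)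
    (h : eLpNorm (fun x => φ x - f x) 2 halfLine < ENNReal.ofReal ε) : ‖f - hφ.toLp φ‖ < ε := by
  have hε : 0 < ε := ENNReal.ofReal_pos.mp (pos_of_gt h)
  rw [← norm_neg, neg_sub, Lp.norm_def]
  refine (ENNReal.toReal_lt_of_lt_ofReal (lt_of_eq_of_lt (eLpNorm_congr_ae ?_) h))
  filter_upwards [Lp.coeFn_sub (hφ.toLp φ) f, hφ.coeFn_toLp] with x h1 h2
  rw [h1, Pi.sub_apply, h2]

/-- `H_{1,0}` consists of the functions in the first Sobolev space that vanish at `0`. -/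
theorem mem_H10_iff {f : L2 ℂ} :
    f ∈ H10 ↔ ∃ f', HasWeakDeriv f f' ∧ HasBoundaryValue f 0 := by
  constructor
  · rintro ⟨g, hg, happ⟩
    obtain ⟨a, ha⟩ := hg.exists_hasBoundaryValue
    refine ⟨g, hg, ?_⟩
    suffices a = 0 by rwa [this] at ha
    -- Test functions vanish at `0`, so subtracting a close one keeps the boundary value `a` while
    -- making the first Sobolev norm small.
    have key : ∀ ε : ℝ, 0 < ε → ‖a‖ ^ 2 ≤ 2 * (ε * ε) := by
      intro ε hε
      obtain ⟨φ, hφ, h1, h2⟩ := happ (ENNReal.ofReal ε) (ENNReal.ofReal_pos.mpr hε)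
      have m1 := hφ.memLp (1 : ℂ)
      have m2 := hφ.memLp_deriv (1 : ℂ)
      have n1 := norm_toLp_sub_lt (f := f) m1 (by simpa using h1)
      have n2 := norm_toLp_sub_lt (f := g) m2 (by simpa using h2)
      have hw : HasWeakDeriv (f - m1.toLp _) (g - m2.toLp _) := by
        have := hg.add ((hφ.hasWeakDeriv (1 : ℂ)).smul (-1))
        simpa only [neg_smul, one_smul, ← sub_eq_add_neg] using this
      have hb : HasBoundaryValue (f - m1.toLp _) a := by
        have := ha.add ((hφ.hasBoundaryValue (1 : ℂ)).smul (-1))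
        simpa only [neg_smul, one_smul, ← sub_eq_add_neg, sub_zero] using this
      obtain ⟨u, hu, hfu, rfl⟩ := hb
      refine (hw.norm_sq_le hfu hu le_rfl).trans ?_
      gcongr
    by_contra hne
    have h0 : 0 < ‖a‖ := norm_pos_iff.mpr hne
    have := key (‖a‖ / 2) (by positivity)
    nlinarith
  · rintro ⟨g, hg, hb⟩
    refine ⟨g, hg, fun ε hε => ?_⟩
    -- The closure is the double orthogonal complement. A vector `p` of the first complement is
    -- `(q', q)`, and its pairing with `(f, f')` is the boundary term `-⟨q 0, f 0⟩`, zero since `f 0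
    -- = 0`.
    have hmem : WithLp.toLp 2 (f, g) ∈ testPairs.topologicalClosure := by
      rw [← Submodule.orthogonal_orthogonal_eq_closure]
      intro p hp
      have hw := hasWeakDeriv_of_mem_orthogonal hp
      obtain ⟨b, hb'⟩ := hw.exists_hasBoundaryValue
      rw [WithLp.prod_inner_apply]
      exact (hw.inner_add_inner hg hb' hb).trans (by rw [inner_zero_right, neg_zero])
    have hcl : WithLp.toLp 2 (f, g) ∈ closure (testPairs : Set (WithLp 2 (L2 ℂ × L2 ℂ))) := hmem
    obtain ⟨p, ⟨φ, hφ, h1, h2⟩, hd⟩ := EMetric.mem_closure_iff.mp hcl ε hε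
    refine ⟨φ, hφ, ?_, ?_⟩
    · have e : eLpNorm (fun x => φ x - f x) 2 halfLine = edist p.fst f := by
        rw [Lp.edist_def]
        exact eLpNorm_congr_ae (by filter_upwards [h1] with x hx; rw [Pi.sub_apply, hx])
      rw [e, edist_comm]
      exact (WithLp.edist_fst_le _ _).trans_lt hd
    · have e : eLpNorm (fun x => deriv φ x - g x) 2 halfLine = edist p.snd g := by
        rw [Lp.edist_def]
        exact eLpNorm_congr_ae (by filter_upwards [h2] with x hx; rw [Pi.sub_apply, hx])
      rw [e, edist_comm]
      exact (WithLp.edist_snd_le _ _).trans_lt hd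

end VanishingBoundaryValue

/-! ### The decaying exponentials and the equation `-w'' = κ² w`. -/

section ExponentialWaves

theorem HasWeakDeriv.congr_right {E : Type*} [NormedAddCommGroup E] [NormedSpace ℂ E]
    {f g g' : L2 E} (h : HasWeakDeriv f g) (e : g = g') : HasWeakDeriv f g' := e ▸ h

theorem HasWeakDeriv.unique {E : Type*} [NormedAddCommGroup E] [NormedSpace ℂ E] [CompleteSpace E]
    {f g g' : L2 E} (h : HasWeakDeriv f g) (h' : HasWeakDeriv f g') : g = g' := by
  have h0 : HasWeakDeriv (0 : L2 E) (g + (-1 : ℂ) • g') := by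
    have := h.add (h'.smul (-1))
    rwa [neg_one_smul, add_neg_cancel] at this
  have := h0.eq_zero
  rwa [neg_one_smul, add_neg_eq_zero] at this

variable {E : Type*} [NormedAddCommGroup E] [InnerProductSpace ℂ E] [CompleteSpace E]

theorem norm_exp_I_mul (κ : ℂ) (x : ℝ) :
    ‖Complex.exp (Complex.I * κ * x)‖ = Real.exp (-κ.im * x) := by
  rw [Complex.norm_exp]
  simp

theorem continuous_exp_I_mul (κ : ℂ) : Continuous fun x : ℝ => Complex.exp (Complex.I * κ * x) := by
  fun_prop

omit [CompleteSpace E] in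
theorem memLp_exp_smul {κ : ℂ} (hκ : 0 < κ.im) (c : E) :
    MemLp (fun x : ℝ => Complex.exp (Complex.I * κ * x) • c) 2 halfLine := by
  have hc : Continuous fun x : ℝ => Complex.exp (Complex.I * κ * x) • c :=
    (continuous_exp_I_mul κ).smul continuous_const
  rw [memLp_two_iff_integrable_sq_norm hc.aestronglyMeasurable]
  have h := (exp_neg_integrableOn_Ioi 0 (b := 2 * κ.im) (by positivity)).mul_const (‖c‖ ^ 2)
  refine h.congr (Filter.Eventually.of_forall fun x => ?_)
  simp only [norm_smul, norm_exp_I_mul]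
  rw [mul_pow, ← Real.exp_nat_mul]
  congr 2
  push_cast
  ring

/-- The function `x ↦ e^{iκx} c`, in `L²` for `Im κ > 0`. -/
def expWave (κ : ℂ) (hκ : 0 < κ.im) (c : E) : L2 E := (memLp_exp_smul hκ c).toLp _

variable {κ : ℂ} (hκ : 0 < κ.im)

omit [CompleteSpace E] in
theorem coeFn_expWave (c : E) :
    expWave κ hκ c =ᵐ[halfLine] fun x : ℝ => Complex.exp (Complex.I * κ * x) • c :=
  MemLp.coeFn_toLp _

omit [CompleteSpace E] in
theorem expWave_add (c d : E) : expWave κ hκ (c + d) = expWave κ hκ c + expWave κ hκ d := by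
  simp only [expWave, smul_add]
  rfl

omit [CompleteSpace E] in
theorem expWave_smul (s : ℂ) (c : E) : expWave κ hκ (s • c) = s • expWave κ hκ c := by
  simp only [expWave, smul_comm _ s]
  rfl

omit [CompleteSpace E] in
theorem expWave_sum {ι : Type*} (F : Finset ι) (c : ι → E) :
    expWave κ hκ (∑ j ∈ F, c j) = ∑ j ∈ F, expWave κ hκ (c j) :=
  map_sum ({ toFun := expWave κ hκ, map_add' := expWave_add hκ,
             map_zero' := by simpa using expWave_smul hκ 0 (0 : E) } : E →+ L2 E) _ _

omit [CompleteSpace E] in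
theorem hasBoundaryValue_expWave (c : E) : HasBoundaryValue (expWave κ hκ c) c :=
  ⟨_, ((continuous_exp_I_mul κ).smul continuous_const).continuousOn, coeFn_expWave hκ c, by simp⟩

theorem hasDerivAt_exp_I_mul (κ : ℂ) (x : ℝ) :
    HasDerivAt (fun x : ℝ => Complex.exp (Complex.I * κ * x))
    (Complex.I * κ * Complex.exp (Complex.I * κ * x)) x := by
  have h : HasDerivAt (fun z : ℂ => Complex.exp (Complex.I * κ * z))
      (Complex.exp (Complex.I * κ * x) * (Complex.I * κ * 1)) (x : ℂ) :=
    ((hasDerivAt_id (x : ℂ)).const_mul (Complex.I * κ)).cexp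
  exact h.comp_ofReal.congr_deriv (by ring)

theorem hasWeakDeriv_expWave (c : E) :
    HasWeakDeriv (expWave κ hκ c) ((Complex.I * κ) • expWave κ hκ c) := by
  intro φ hφ
  set e : ℝ → ℂ := fun x => Complex.exp (Complex.I * κ * x) with he
  have hec : Continuous e := continuous_exp_I_mul κ
  have hz {F : ℝ → ℂ} (χ : ℝ → ℂ) (hF : tsupport F ⊆ Ioi 0) (x : ℝ) (hx : x ∉ Ioi (0 : ℝ)) :
      (χ x * F x) • c = 0 := by
    rw [image_eq_zero_of_notMem_tsupport fun hm => hx (hF hm), mul_zero, zero_smul]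
  have e1 : ∫ x in Ioi (0 : ℝ), deriv φ x • expWave κ hκ c x = (∫ x, e x * deriv φ x) • c := by
    rw [← integral_smul_const, ← setIntegral_eq_integral_of_forall_compl_eq_zero
      (hz e (tsupport_deriv_subset.trans hφ.2.2))]
    refine integral_congr_ae ?_
    filter_upwards [coeFn_expWave hκ c] with x hx
    rw [hx, smul_smul, mul_comm]
  have e2 : ∫ x in Ioi (0 : ℝ), φ x • ((Complex.I * κ) • expWave κ hκ c : L2 E) x
      = (∫ x, Complex.I * κ * e x * φ x) • c := by
    rw [← integral_smul_const, ← setIntegral_eq_integral_of_forall_compl_eq_zero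
      (hz (fun x => Complex.I * κ * e x) hφ.2.2)]
    refine integral_congr_ae ?_
    filter_upwards [coeFn_expWave hκ c, Lp.coeFn_smul (Complex.I * κ) (expWave κ hκ c)] with x hx hs
    rw [hs, Pi.smul_apply, hx, smul_smul, smul_smul]
    congr 1
    ring
  have int {u v : ℝ → ℂ} (hu : Continuous u) (hv : Continuous v) (hs : HasCompactSupport v) :
      Integrable (u * v) := (hu.mul hv).integrable_of_hasCompactSupport hs.mul_left
  rw [e1, e2, ← neg_smul]
  congr 1
  exact integral_mul_deriv_eq_deriv_mul_of_integrable
    (fun x _ => hasDerivAt_exp_I_mul κ x) (fun x _ => hφ.hasDerivAt x)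
    (int hec hφ.continuous_deriv hφ.2.1.deriv)
    (int (continuous_const.mul hec) hφ.1.continuous hφ.2.1)
    (int hec hφ.1.continuous hφ.2.1)

/-- The energy identity for a solution of `q' = c q`. -/
theorem HasWeakDeriv.energy {q : L2 E} {c : ℂ} (h : HasWeakDeriv q (c • q)) {a : E}
    (ha : HasBoundaryValue q a) : 2 * c.re * ‖q‖ ^ 2 = -‖a‖ ^ 2 := by
  have h1 := h.inner_add_inner h ha ha
  rw [inner_smul_left, inner_smul_right, ← add_mul, inner_self_eq_norm_sq_to_K,
    inner_self_eq_norm_sq_to_K, add_comm, Complex.add_conj] at h1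
  have h2 := congrArg Complex.re h1
  simpa [← Complex.ofReal_pow] using h2

/-- The energy identity with coefficient `iκ`, whose real part is `-Im κ`, replaces the computation
of an integral. -/
theorem norm_sq_expWave (c : E) : ‖expWave κ hκ c‖ ^ 2 = ‖c‖ ^ 2 / (2 * κ.im) := by
  have h := (hasWeakDeriv_expWave hκ c).energy (hasBoundaryValue_expWave hκ c)
  rw [eq_div_iff (by positivity)]
  simp at h
  linarith

/-- A growing exponential is not in `L²`: in the energy identity the two sides have opposite signs.
-/
theorem HasWeakDeriv.eq_zero_of_re_pos {q : L2 E} {c : ℂ} (h : HasWeakDeriv q (c • q))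
    (hc : 0 < c.re) : q = 0 := by
  obtain ⟨a, ha⟩ := h.exists_hasBoundaryValue
  have h1 := h.energy ha
  by_contra hq
  have : 0 < ‖q‖ := norm_pos_iff.mpr hq
  have h2 : 0 < 2 * c.re * ‖q‖ ^ 2 := by positivity
  linarith [sq_nonneg ‖a‖]

/-- The solutions of `-w'' = κ² w` in `L²` are the multiples of `e^{iκx}`. -/
theorem eq_expWave_of_hasWeakDeriv {w p : L2 E} (hw : HasWeakDeriv w p)
    (hp : HasWeakDeriv p (-(κ ^ 2) • w)) :
    ∃ a, w = expWave κ hκ a ∧ p = (Complex.I * κ) • w := by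
  -- The operator factors as `(d/dx + iκ)(d/dx - iκ)`. The function `q = w' - iκ w` satisfies `q' =
  -- -iκ q` with `Re (-iκ) = Im κ > 0`, so `q = 0`.
  have hq : HasWeakDeriv (p + (-(Complex.I * κ)) • w)
      ((-(Complex.I * κ)) • (p + (-(Complex.I * κ)) • w)) := by
    have := hp.add (hw.smul (-(Complex.I * κ)))
    convert this using 1
    rw [smul_add, smul_smul, add_comm]
    congr 2
    ring_nf
    rw [Complex.I_sq]
    ring
  have h0 := hq.eq_zero_of_re_pos (by simpa using hκ)
  have hpw : p = (Complex.I * κ) • w := by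
    rw [neg_smul, ← sub_eq_add_neg, sub_eq_zero] at h0
    exact h0
  obtain ⟨a, ha⟩ := hw.exists_hasBoundaryValue
  refine ⟨a, ?_, hpw⟩
  have hd : HasWeakDeriv (w + (-1 : ℂ) • expWave κ hκ a)
      ((Complex.I * κ) • (w + (-1 : ℂ) • expWave κ hκ a)) := by
    have := hw.add ((hasWeakDeriv_expWave hκ a).smul (-1))
    rwa [hpw, smul_comm (-1 : ℂ), ← smul_add] at this
  have hb := ha.add ((hasBoundaryValue_expWave hκ a).smul (-1))
  -- The difference of `w` and the exponential with the same boundary value solves the first order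
  -- equation with boundary value `0`, so the energy identity makes it vanish.
  have he := hd.energy hb
  have hz : ‖w + (-1 : ℂ) • expWave κ hκ a‖ = 0 := by
    have h3 : (Complex.I * κ).re = -κ.im := by simp
    rw [h3] at he
    have : κ.im * ‖w + (-1 : ℂ) • expWave κ hκ a‖ ^ 2 = 0 := by
      have : a + (-1 : ℂ) • a = 0 := by simp
      rw [this] at he
      simp only [norm_zero] at he
      linarith
    simpa [hκ.ne'] using this
  rw [norm_eq_zero, neg_one_smul, ← sub_eq_add_neg, sub_eq_zero] at hz
  exact hz

end ExponentialWaves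

/-! ### Bounding the trace norm through polar decomposition. -/

section TraceNormBound

variable {X : Type*} [NormedAddCommGroup X] [InnerProductSpace ℂ X] [CompleteSpace X]

theorem norm_cfcAbs_apply (T : X →L[ℂ] X) (x : X) : ‖CFC.abs T x‖ = ‖T x‖ := by
  have hsa : star (CFC.abs T) = CFC.abs T := (CFC.abs_nonneg T).isSelfAdjoint
  have key : (inner ℂ (CFC.abs T x) (CFC.abs T x) : ℂ) = inner ℂ (T x) (T x) := by
    rw [← ContinuousLinearMap.adjoint_inner_left, ← ContinuousLinearMap.adjoint_inner_left,
      ← ContinuousLinearMap.star_eq_adjoint, ← ContinuousLinearMap.star_eq_adjoint, hsa]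
    have := congrArg (fun S : X →L[ℂ] X => S x) (CFC.abs_mul_abs T)
    simp only [mul_apply_eq_comp] at this
    rw [this]
  rw [inner_self_eq_norm_sq_to_K, inner_self_eq_norm_sq_to_K] at key
  have h2 : ‖CFC.abs T x‖ ^ 2 = ‖T x‖ ^ 2 := by exact_mod_cast key
  exact (pow_left_inj₀ (norm_nonneg _) (norm_nonneg _) two_ne_zero).mp h2

/-- Polar decomposition: `T = W |T|` with a contraction `W`. -/
theorem exists_contraction_comp_cfcAbs (T : X →L[ℂ] X) :
    ∃ W : X →L[ℂ] X, ‖W‖ ≤ 1 ∧ ∀ x, W (CFC.abs T x) = T x := by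
  set S := CFC.abs T with hS
  -- `|T| x ↦ T x` is isometric on the range of `|T|`; it extends to the closure `K`, and by zero to
  -- the orthogonal complement.
  set K := (LinearMap.range (S : X →ₗ[ℂ] X)).topologicalClosure with hK
  have : CompleteSpace K := (Submodule.isClosed_topologicalClosure _).completeSpace_coe
  have hmem (x : X) : S x ∈ K := Submodule.le_topologicalClosure _ ⟨x, rfl⟩
  let e : X →ₗ[ℂ] K := (S : X →ₗ[ℂ] X).codRestrict K hmem
  have hdense : DenseRange e := by
    intro y
    rw [closure_subtype]
    have : ((↑) '' range e : Set X) = range S := by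
      ext z
      constructor
      · rintro ⟨_, ⟨x, rfl⟩, rfl⟩; exact ⟨x, rfl⟩
      · rintro ⟨x, rfl⟩; exact ⟨e x, ⟨x, rfl⟩, rfl⟩
    rw [this]
    exact y.2
  have hn : ∀ x, ‖(T : X →ₗ[ℂ] X) x‖ ≤ 1 * ‖e x‖ := fun x => by
    rw [one_mul]
    exact (norm_cfcAbs_apply T x).symm.le
  let U : K →L[ℂ] X := (T : X →ₗ[ℂ] X).extendOfNorm e
  have hU : ‖U‖ ≤ 1 := LinearMap.opNorm_extendOfNorm_le hdense zero_le_one hn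
  refine ⟨U ∘L K.orthogonalProjectionOnto, ?_, fun x => ?_⟩
  · refine (ContinuousLinearMap.opNorm_comp_le _ _).trans ?_
    exact mul_le_one₀ hU (norm_nonneg _) (Submodule.orthogonalProjectionOnto_norm_le _)
  · have h1 : K.orthogonalProjectionOnto (S x) = e x :=
      Submodule.orthogonalProjectionOnto_mem_subspace_eq_self (e x)
    rw [ContinuousLinearMap.comp_apply, h1]
    exact LinearMap.extendOfNorm_eq hdense ⟨1, hn⟩ x

/-- Expanding `‖W* W v - v‖²` gives at most `‖v‖² - 2‖W v‖² + ‖v‖² = 0`. -/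
theorem adjoint_apply_apply_of_norm_eq {W : X →L[ℂ] X} (hW : ‖W‖ ≤ 1) {v : X}
    (hv : ‖W v‖ = ‖v‖) : W.adjoint (W v) = v := by
  have h1 : ‖W.adjoint (W v)‖ ≤ ‖v‖ := by
    rw [← hv]
    refine (W.adjoint.le_opNorm _).trans (mul_le_of_le_one_left (norm_nonneg _) ?_)
    rwa [LinearIsometryEquiv.norm_map]
  have h2 := norm_sub_sq (𝕜 := ℂ) (W.adjoint (W v)) v
  rw [ContinuousLinearMap.adjoint_inner_left, inner_self_eq_norm_sq, hv] at h2
  have h3 : ‖W.adjoint (W v) - v‖ ^ 2 ≤ 0 := by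
    have := mul_self_le_mul_self (norm_nonneg _) h1
    nlinarith
  have h4 : ‖W.adjoint (W v) - v‖ = 0 := pow_eq_zero_iff two_ne_zero |>.mp
    (le_antisymm h3 (sq_nonneg _))
  exact sub_eq_zero.mp (norm_eq_zero.mp h4)

/-- The trace norm of `T` is bounded by any bound on the sums `∑ |⟨W eᵢ, T eᵢ⟩|` over finite
orthonormal families, with contractions `W`. -/
theorem traceNorm_le_of_forall_sum_le {T : X →L[ℂ] X} {C : ℝ}
    (h : ∀ W : X →L[ℂ] X, ‖W‖ ≤ 1 → ∀ (s : Set X) (e : s → X), Orthonormal ℂ e →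
      ∀ F : Finset s, ∑ i ∈ F, ‖(inner ℂ (W (e i)) (T (e i)) : ℂ)‖ ≤ C) :
    traceNorm T ≤ ENNReal.ofReal C := by
  obtain ⟨W, hW, hWT⟩ := exists_contraction_comp_cfcAbs T
  -- `W` preserves the norm on the range of `|T|`, so `T = W |T|` inverts to `|T| = W* T`.
  have hle (x : X) : (inner ℂ (CFC.abs T x) x : ℂ) = inner ℂ (T x) (W x) := by
    have h1 := adjoint_apply_apply_of_norm_eq (v := CFC.abs T x) hW
      (by rw [hWT, norm_cfcAbs_apply])
    rw [hWT] at h1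
    rw [← h1, ContinuousLinearMap.adjoint_inner_left]
  refine iSup_le fun s => iSup_le fun e => ?_
  rw [ENNReal.tsum_eq_iSup_sum]
  refine iSup_le fun F => ?_
  refine le_trans ?_ (ENNReal.ofReal_le_ofReal (h W hW s e e.orthonormal F))
  rw [ENNReal.ofReal_sum_of_nonneg fun _ _ => norm_nonneg _]
  refine Finset.sum_le_sum fun i _ => ENNReal.ofReal_le_ofReal ?_
  rw [hle, norm_inner_symm]
  exact RCLike.re_le_norm _

end TraceNormBound

/-! ### Existence of diagonal representations and the diagonal boundary condition. -/

section DiagonalRepresentation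

variable {n : ℕ} {A B : Matrix (Fin n) (Fin n) ℂ}

/-- The cross terms `i (A†B - B†A)` of `(A + iB)† (A + iB)` cancel, leaving a positive definite
matrix. -/
theorem det_add_I_smul_ne_zero (hAB : -Bᴴ * A + Aᴴ * B = 0) (hpos : (Aᴴ * A + Bᴴ * B).PosDef) :
    (A + Complex.I • B).det ≠ 0 := by
  have h : (A + Complex.I • B)ᴴ * (A + Complex.I • B) = Aᴴ * A + Bᴴ * B := by
    have hAB' : Aᴴ * B = Bᴴ * A := by
      rwa [neg_mul, neg_add_eq_zero, eq_comm] at hAB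
    rw [Matrix.conjTranspose_add, Matrix.conjTranspose_smul, add_mul, mul_add, mul_add]
    simp only [RCLike.star_def, Complex.conj_I, Matrix.smul_mul, Matrix.mul_smul, smul_smul, hAB']
    simp only [mul_neg, Complex.I_mul_I, neg_neg, one_smul, neg_smul]
    abel
  intro h0
  have := hpos.det_pos
  rw [← h, Matrix.det_mul, h0, mul_zero] at this
  exact lt_irrefl _ this

open Polynomial in
-- `det (A + zB)` is a polynomial in `z` that is nonzero at `i`, so it cannot vanish on the whole
-- real line. A real parameter is what keeps the later quotient Hermitian.
theorem exists_real_det_add_smul_ne_zero (h : (A + Complex.I • B).det ≠ 0) :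
    ∃ t : ℝ, (A + (t : ℂ) • B).det ≠ 0 := by
  set p : ℂ[X] := (A.map C + (X : ℂ[X]) • B.map C).det with hp
  have hev (z : ℂ) : p.eval z = (A + z • B).det := by
    rw [hp, ← Polynomial.coe_evalRingHom, RingHom.map_det]
    congr 1
    ext i j
    simp
    exact mul_comm _ _
  have hp0 : p ≠ 0 := by
    intro h0
    rw [← hev, h0, eval_zero] at h
    exact h rfl
  by_contra! hall
  refine hp0 (Polynomial.eq_zero_of_infinite_isRoot p ?_)
  refine (Set.infinite_range_of_injective Complex.ofReal_injective).mono ?_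
  rintro _ ⟨t, rfl⟩
  exact (hev t).trans (hall t)

/-- Polar coordinates of `y - ix`. A nonpositive argument is shifted by `π` at the cost of a
negative `ρ`, which brings the angle into `(0, π]`. -/
theorem exists_angle (x y : ℝ) (h : x ≠ 0 ∨ y ≠ 0) :
    ∃ ρ θ : ℝ, ρ ≠ 0 ∧ θ ∈ Ioc 0 Real.pi ∧ x = -(Real.sin θ * ρ) ∧ y = Real.cos θ * ρ := by
  set z : ℂ := ⟨y, -x⟩ with hz
  have hz0 : ‖z‖ ≠ 0 := by
    rw [norm_ne_zero_iff]
    intro h0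
    have h1 := congrArg Complex.re h0
    have h2 := congrArg Complex.im h0
    simp [hz] at h1 h2
    tauto
  have hc := Complex.norm_mul_cos_arg z
  have hs := Complex.norm_mul_sin_arg z
  simp only [hz] at hc hs
  rw [← hz] at hc hs
  rcases lt_or_ge 0 z.arg with h0 | h0
  · exact ⟨‖z‖, z.arg, hz0, ⟨h0, Complex.arg_le_pi z⟩, by linarith, by linarith⟩
  · refine ⟨-‖z‖, z.arg + Real.pi, neg_ne_zero.mpr hz0,
      ⟨by linarith [Complex.neg_pi_lt_arg z], by linarith⟩, ?_, ?_⟩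
    · rw [Real.sin_add_pi]; linarith
    · rw [Real.cos_add_pi]; linarith

theorem exists_isDiagonalRepr (hAB : -Bᴴ * A + Aᴴ * B = 0) (hpos : (Aᴴ * A + Bᴴ * B).PosDef) :
    ∃ (M : Matrix (Fin n) (Fin n) ℂ) (θ : Fin n → ℝ), IsDiagonalRepr A B M θ := by
  obtain ⟨t, ht⟩ := exists_real_det_add_smul_ne_zero (det_add_I_smul_ne_zero hAB hpos)
  have hAB' : Aᴴ * B = Bᴴ * A := by rwa [neg_mul, neg_add_eq_zero, eq_comm] at hAB
  -- A real linear change of the pair that makes the first member invertible. It is undone by `(1 +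
  -- t²) A = P - tQ` and `(1 + t²) B = Q + tP`, so `(1 - tλ_j)/(1 + t²)` and `(λ_j + t)/(1 + t²)`
  -- are the eigenvalues of `A P⁻¹` and `B P⁻¹`.
  set P := A + (t : ℂ) • B with hP
  set Q := B - (t : ℂ) • A with hQ
  have hPu : IsUnit P := (Matrix.isUnit_iff_isUnit_det _).mpr (isUnit_iff_ne_zero.mpr ht)
  have hdet : IsUnit P.det := isUnit_iff_ne_zero.mpr ht
  have hPQ : Pᴴ * Q = Qᴴ * P := by
    simp only [hP, hQ, Matrix.conjTranspose_add, Matrix.conjTranspose_sub,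
      Matrix.conjTranspose_smul, RCLike.star_def, Complex.conj_ofReal, add_mul, mul_add, sub_mul,
      mul_sub, Matrix.smul_mul, Matrix.mul_smul, hAB']
    abel
  have hL : (Q * P⁻¹).IsHermitian := by
    have h1 : Pᴴ * (Q * P⁻¹)ᴴ * P = Pᴴ * (Q * P⁻¹) * P := by
      rw [Matrix.conjTranspose_mul, ← Matrix.mul_assoc, ← Matrix.conjTranspose_mul,
        Matrix.nonsing_inv_mul _ hdet, Matrix.conjTranspose_one, one_mul, ← hPQ, mul_assoc,
        mul_assoc, Matrix.nonsing_inv_mul _ hdet, mul_one]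
    exact hPu.star.mul_left_cancel (hPu.mul_right_cancel h1)
  set lam := hL.eigenvalues with hlam
  set M : Matrix (Fin n) (Fin n) ℂ := (hL.eigenvectorUnitary).1 with hM
  have hMM : M * Mᴴ = 1 := Matrix.mem_unitaryGroup_iff.mp hL.eigenvectorUnitary.2
  have hspec : Q * P⁻¹ = M * Matrix.diagonal (fun j => (lam j : ℂ)) * Mᴴ := by
    have := hL.spectral_theorem
    rw [Unitary.conjStarAlgAut_apply] at this
    exact this
  have hQ' : Q = M * Matrix.diagonal (fun j => (lam j : ℂ)) * Mᴴ * P := by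
    rw [← hspec, mul_assoc, Matrix.nonsing_inv_mul _ hdet, mul_one]
  have hP' : P = M * Mᴴ * P := by rw [hMM, one_mul]
  have hc : (1 + t ^ 2 : ℝ) ≠ 0 := by positivity
  have hex : ∀ j, ∃ ρ θ : ℝ, ρ ≠ 0 ∧ θ ∈ Ioc 0 Real.pi ∧
      (1 - t * lam j) / (1 + t ^ 2) = -(Real.sin θ * ρ) ∧
      (lam j + t) / (1 + t ^ 2) = Real.cos θ * ρ := fun j => by
    refine exists_angle _ _ ?_
    -- If both entries vanished, then `λ_j = -t` and hence `1 + t² = 0`.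
    by_contra! h
    have h1 := (div_eq_zero_iff.mp h.1).resolve_right hc
    have h2 := (div_eq_zero_iff.mp h.2).resolve_right hc
    have : lam j = -t := by linarith
    rw [this] at h1
    nlinarith [sq_nonneg t]
  choose ρ θ hρ hθ hsin hcos using hex
  have hcC : ((1 + t ^ 2 : ℝ) : ℂ) ≠ 0 := by exact_mod_cast hc
  have hA : A = ((1 + t ^ 2 : ℝ) : ℂ)⁻¹ • (P - (t : ℂ) • Q) := by
    rw [eq_inv_smul_iff₀ hcC, hP, hQ, smul_sub, smul_smul]
    push_cast
    rw [add_smul, one_smul, pow_two]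
    abel
  have hB : B = ((1 + t ^ 2 : ℝ) : ℂ)⁻¹ • (Q + (t : ℂ) • P) := by
    rw [eq_inv_smul_iff₀ hcC, hP, hQ, smul_add, smul_smul]
    push_cast
    rw [add_smul, one_smul, pow_two]
    abel
  refine ⟨M, θ, hL.eigenvectorUnitary.2, hθ, P, Matrix.diagonal fun j => (ρ j : ℂ), hPu, ?_, ?_, ?_⟩
  · rw [Matrix.isUnit_iff_isUnit_det, Matrix.det_diagonal, isUnit_iff_ne_zero,
      Finset.prod_ne_zero_iff]
    exact fun j _ => Complex.ofReal_ne_zero.mpr (hρ j)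
  · have hd : (-Matrix.diagonal fun j => (Real.sin (θ j) : ℂ)) * (Matrix.diagonal fun j => (ρ j : ℂ))
        = ((1 + t ^ 2 : ℝ) : ℂ)⁻¹ • (1 - (t : ℂ) • Matrix.diagonal fun j => (lam j : ℂ)) := by
      rw [Matrix.diagonal_neg, Matrix.diagonal_mul_diagonal, ← Matrix.diagonal_one,
        ← Matrix.diagonal_smul, Matrix.diagonal_sub, ← Matrix.diagonal_smul]
      congr 1
      funext j
      have := congrArg (fun r : ℝ => (r : ℂ)) (hsin j)
      simp only [Complex.ofReal_neg, Complex.ofReal_mul, Complex.ofReal_div] at this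
      simp only [Pi.smul_apply, smul_eq_mul, neg_mul, ← this]
      push_cast
      rw [div_eq_inv_mul]
    rw [mul_assoc M, hd, hA]
    conv_lhs => rw [hQ']
    conv_lhs => enter [2, 1]; rw [hP']
    simp only [Matrix.mul_smul, Matrix.smul_mul, mul_sub, sub_mul, mul_one]
  · have hd : (Matrix.diagonal fun j => (Real.cos (θ j) : ℂ)) * (Matrix.diagonal fun j => (ρ j : ℂ))
        = ((1 + t ^ 2 : ℝ) : ℂ)⁻¹ • ((Matrix.diagonal fun j => (lam j : ℂ)) + (t : ℂ) • 1) := by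
      rw [Matrix.diagonal_mul_diagonal, ← Matrix.diagonal_one,
        ← Matrix.diagonal_smul, Matrix.diagonal_add, ← Matrix.diagonal_smul]
      congr 1
      funext j
      have := congrArg (fun r : ℝ => (r : ℂ)) (hcos j)
      simp only [Complex.ofReal_mul, Complex.ofReal_div] at this
      simp only [Pi.smul_apply, smul_eq_mul, mul_one, ← this]
      push_cast
      rw [div_eq_inv_mul]
    rw [mul_assoc M, hd, hB]
    conv_lhs => rw [hQ']
    conv_lhs => enter [2, 2]; rw [hP']
    simp only [Matrix.mul_smul, Matrix.smul_mul, mul_add, add_mul, mul_one]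

theorem toEuclideanCLM_mul_apply (S T : Matrix (Fin n) (Fin n) ℂ) (x : Cn n) :
    Matrix.toEuclideanCLM (𝕜 := ℂ) (S * T) x =
      Matrix.toEuclideanCLM (𝕜 := ℂ) S (Matrix.toEuclideanCLM (𝕜 := ℂ) T x) := by
  rw [map_mul]; rfl

theorem toEuclideanCLM_diagonal_apply (d : Fin n → ℂ) (x : Cn n) (j : Fin n) :
    Matrix.toEuclideanCLM (𝕜 := ℂ) (Matrix.diagonal d) x j = d j * x j := by
  rw [Matrix.ofLp_toEuclideanCLM, Matrix.mulVec_diagonal]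

theorem toEuclideanCLM_apply_eq_zero_iff {S : Matrix (Fin n) (Fin n) ℂ} (hS : IsUnit S) {x : Cn n} :
    Matrix.toEuclideanCLM (𝕜 := ℂ) S x = 0 ↔ x = 0 := by
  refine ⟨fun h => ?_, fun h => by rw [h, map_zero]⟩
  obtain ⟨⟨S, S', h1, h2⟩, rfl⟩ := hS
  have := congrArg (Matrix.toEuclideanCLM (𝕜 := ℂ) S') h
  simp only at this
  rwa [← toEuclideanCLM_mul_apply, h2, map_one, map_zero] at this

variable {M : Matrix (Fin n) (Fin n) ℂ} {θ : Fin n → ℝ}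

/-- The boundary condition in the coordinates of a diagonal representation. -/
theorem IsDiagonalRepr.boundary_iff (h : IsDiagonalRepr A B M θ) (a b : Cn n) :
    -Matrix.toEuclideanCLM (𝕜 := ℂ) Bᴴ a + Matrix.toEuclideanCLM (𝕜 := ℂ) Aᴴ b = 0 ↔
      ∀ j, (Real.cos (θ j) : ℂ) * Matrix.toEuclideanCLM (𝕜 := ℂ) Mᴴ a j +
        (Real.sin (θ j) : ℂ) * Matrix.toEuclideanCLM (𝕜 := ℂ) Mᴴ b j = 0 := by
  obtain ⟨T₁, T₂, h1, h2, rfl, rfl⟩ := h.repr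
  have hM : IsUnit M := ⟨⟨M, Mᴴ, Matrix.mem_unitaryGroup_iff.mp h.unitary,
    Matrix.mem_unitaryGroup_iff'.mp h.unitary⟩, rfl⟩
  -- After taking adjoints, `T₁† M T₂†` is a common invertible left factor of both terms and drops
  -- out.
  have hu : IsUnit (T₁ᴴ * M * T₂ᴴ) := (h1.star.mul hM).mul h2.star
  have hreal (f : ℝ → ℝ) : (Matrix.diagonal fun j => (f (θ j) : ℂ))ᴴ =
      Matrix.diagonal fun j => (f (θ j) : ℂ) := by
    rw [Matrix.diagonal_conjTranspose]
    congr 1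
    funext j
    simp
  set Dc : Matrix (Fin n) (Fin n) ℂ := Matrix.diagonal fun j => (Real.cos (θ j) : ℂ) with hDc
  set Ds : Matrix (Fin n) (Fin n) ℂ := Matrix.diagonal fun j => (Real.sin (θ j) : ℂ) with hDs
  have eB : (M * Dc * T₂ * Mᴴ * T₁)ᴴ = T₁ᴴ * M * T₂ᴴ * (Dc * Mᴴ) := by
    simp only [Matrix.conjTranspose_mul, Matrix.conjTranspose_conjTranspose, hDc, hreal, mul_assoc]
  have eA : (M * -Ds * T₂ * Mᴴ * T₁)ᴴ = -(T₁ᴴ * M * T₂ᴴ * (Ds * Mᴴ)) := by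
    simp only [Matrix.conjTranspose_mul, Matrix.conjTranspose_conjTranspose,
      Matrix.conjTranspose_neg, hDs, hreal, mul_assoc, neg_mul, mul_neg]
  rw [eA, eB, map_neg, neg_apply, ← neg_add, neg_eq_zero,
    toEuclideanCLM_mul_apply (T₁ᴴ * M * T₂ᴴ), toEuclideanCLM_mul_apply (T₁ᴴ * M * T₂ᴴ), ← map_add,
    toEuclideanCLM_apply_eq_zero_iff hu, toEuclideanCLM_mul_apply, toEuclideanCLM_mul_apply]
  constructor
  · intro h j
    have := congrArg (fun x : Cn n => x j) h
    simpa only [PiLp.add_apply, PiLp.zero_apply, hDc, hDs, toEuclideanCLM_diagonal_apply] using this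
  · intro h
    ext j
    simpa only [PiLp.add_apply, PiLp.zero_apply, hDc, hDs, toEuclideanCLM_diagonal_apply] using h j

end DiagonalRepresentation

/-! ### The finite rank formula for the difference of the free resolvents. -/

section FreeResolvents

theorem IsResolventAt.mem_graph {X : Type*} [NormedAddCommGroup X] [NormedSpace ℂ X]
    {D : X →ₗ.[ℂ] X} {z : ℂ} {R : X →L[ℂ] X} (h : IsResolventAt D z R) (f : X) :
    (R f, f + z • R f) ∈ D.graph := by
  obtain ⟨hm, he⟩ := h.1 f
  rw [LinearPMap.mem_graph_iff]
  exact ⟨⟨R f, hm⟩, rfl, sub_eq_iff_eq_add.mp he⟩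

theorem IsResolventAt.apply_of_mem_graph {X : Type*} [NormedAddCommGroup X] [NormedSpace ℂ X]
    {D : X →ₗ.[ℂ] X} {z : ℂ} {R : X →L[ℂ] X} (h : IsResolventAt D z R) {u w : X}
    (hu : (u, w) ∈ D.graph) : R (w - z • u) = u := by
  rw [LinearPMap.mem_graph_iff] at hu
  obtain ⟨y, hy, hw⟩ := hu
  simp only at hy hw
  rw [← hy, ← hw]
  exact h.2 y

/-- A finite rank operator is trace class. -/
theorem traceNorm_le_of_finite_rank {X : Type*} [NormedAddCommGroup X] [InnerProductSpace ℂ X]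
    [CompleteSpace X] {ι : Type*} [Fintype ι] {T : X →L[ℂ] X} {c : ι → ℂ} {φ ψ : ι → X}
    (hT : ∀ f, T f = ∑ j, (c j * inner ℂ (ψ j) f) • φ j) :
    traceNorm T ≤ ENNReal.ofReal (∑ j, ‖c j‖ * ((‖ψ j‖ ^ 2 + ‖φ j‖ ^ 2) / 2)) := by
  refine traceNorm_le_of_forall_sum_le fun W hW s e he F => ?_
  have h1 (i : s) : ‖(inner ℂ (W (e i)) (T (e i)) : ℂ)‖ ≤
      ∑ j, ‖c j‖ * ((‖(inner ℂ (e i) (ψ j) : ℂ)‖ ^ 2 +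
        ‖(inner ℂ (e i) (W.adjoint (φ j)) : ℂ)‖ ^ 2) / 2) := by
    rw [hT, inner_sum]
    refine (norm_sum_le _ _).trans (Finset.sum_le_sum fun j _ => ?_)
    rw [inner_smul_right, norm_mul, norm_mul, ContinuousLinearMap.adjoint_inner_right,
      norm_inner_symm (ψ j), mul_assoc]
    refine mul_le_mul_of_nonneg_left ?_ (norm_nonneg _)
    -- The arithmetic-geometric mean inequality separates the factors so that Bessel applies to
    -- each. It loses nothing when `‖ψ j‖ = ‖φ j‖`, as for the exponentials used later.
    nlinarith [sq_nonneg (‖(inner ℂ (e i) (ψ j) : ℂ)‖ - ‖(inner ℂ (W (e i)) (φ j) : ℂ)‖)]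
  refine (Finset.sum_le_sum fun i _ => h1 i).trans ?_
  rw [Finset.sum_comm]
  refine Finset.sum_le_sum fun j _ => ?_
  rw [← Finset.mul_sum, ← Finset.sum_div, Finset.sum_add_distrib]
  have h2 := he.sum_inner_products_le (ψ j) (s := F)
  have h3 := he.sum_inner_products_le (W.adjoint (φ j)) (s := F)
  have h4 : ‖W.adjoint (φ j)‖ ≤ ‖φ j‖ := by
    refine (W.adjoint.le_opNorm _).trans (mul_le_of_le_one_left (norm_nonneg _) ?_)
    rwa [LinearIsometryEquiv.norm_map]
  have h5 : ‖W.adjoint (φ j)‖ ^ 2 ≤ ‖φ j‖ ^ 2 := by gcongr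
  refine mul_le_mul_of_nonneg_left ?_ (norm_nonneg _)
  linarith

variable {n : ℕ} {A B M : Matrix (Fin n) (Fin n) ℂ} {θ : Fin n → ℝ}

theorem mem_graph_neumannHamiltonian_iff {p : L2 (Cn n) × L2 (Cn n)} :
    p ∈ (neumannHamiltonian n).graph ↔ ∃ u', HasWeakDeriv p.1 u' ∧ HasWeakDeriv u' (-p.2) ∧
      HasBoundaryValue u' 0 := by
  rw [neumannHamiltonian, freeHamiltonian_graph]
  have key (a b : Cn n) : -Matrix.toEuclideanCLM (𝕜 := ℂ) (0 : Matrix (Fin n) (Fin n) ℂ)ᴴ a +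
      Matrix.toEuclideanCLM (𝕜 := ℂ) (-1 : Matrix (Fin n) (Fin n) ℂ)ᴴ b = 0 ↔ b = 0 := by
    rw [Matrix.conjTranspose_zero, Matrix.conjTranspose_neg, Matrix.conjTranspose_one, map_zero,
      map_neg, map_one]
    simp
  constructor
  · rintro ⟨u', h1, h2, a, b, -, hb, hab⟩
    rw [(key a b).mp hab] at hb
    exact ⟨u', h1, h2, hb⟩
  · rintro ⟨u', h1, h2, hb⟩
    obtain ⟨a, ha⟩ := h1.exists_hasBoundaryValue
    exact ⟨u', h1, h2, a, 0, ha, hb, (key a 0).mpr rfl⟩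

/-- The `j`-th column of `M`. -/
def columnVec (M : Matrix (Fin n) (Fin n) ℂ) (j : Fin n) : Cn n :=
  Matrix.toEuclideanCLM (𝕜 := ℂ) M (EuclideanSpace.single j 1)

theorem inner_toEuclideanCLM_right (S : Matrix (Fin n) (Fin n) ℂ) (x y : Cn n) :
    (inner ℂ x (Matrix.toEuclideanCLM (𝕜 := ℂ) S y) : ℂ) =
      inner ℂ (Matrix.toEuclideanCLM (𝕜 := ℂ) Sᴴ x) y := by
  rw [← Matrix.star_eq_conjTranspose, map_star, ContinuousLinearMap.star_eq_adjoint,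
    ContinuousLinearMap.adjoint_inner_left]

theorem inner_columnVec (M : Matrix (Fin n) (Fin n) ℂ) (j : Fin n) (a : Cn n) :
    (inner ℂ (columnVec M j) a : ℂ) = Matrix.toEuclideanCLM (𝕜 := ℂ) Mᴴ a j := by
  have h := inner_toEuclideanCLM_right Mᴴ (EuclideanSpace.single j (1 : ℂ)) a
  rw [Matrix.conjTranspose_conjTranspose] at h
  rw [columnVec, ← h, EuclideanSpace.inner_single_left, map_one, one_mul]

theorem toEuclideanCLM_conjTranspose_columnVec (hM : M ∈ Matrix.unitaryGroup (Fin n) ℂ)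
    (j : Fin n) :
    Matrix.toEuclideanCLM (𝕜 := ℂ) Mᴴ (columnVec M j) = EuclideanSpace.single j 1 := by
  rw [columnVec, ← toEuclideanCLM_mul_apply, ← Matrix.star_eq_conjTranspose,
    Matrix.mem_unitaryGroup_iff'.mp hM, map_one]
  rfl

theorem norm_columnVec (hM : M ∈ Matrix.unitaryGroup (Fin n) ℂ) (j : Fin n) :
    ‖columnVec M j‖ = 1 := by
  have h := inner_columnVec M j (columnVec M j)
  rw [toEuclideanCLM_conjTranspose_columnVec hM, inner_self_eq_norm_sq_to_K] at h
  have h2 : ‖columnVec M j‖ ^ 2 = 1 := by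
    have : ((‖columnVec M j‖ ^ 2 : ℝ) : ℂ) = ((1 : ℝ) : ℂ) := by simpa using h
    exact Complex.ofReal_injective this
  exact (pow_eq_one_iff_of_nonneg (norm_nonneg _) two_ne_zero).mp h2

theorem sum_smul_columnVec (hM : M ∈ Matrix.unitaryGroup (Fin n) ℂ) (a : Cn n) :
    ∑ j, (Matrix.toEuclideanCLM (𝕜 := ℂ) Mᴴ a j) • columnVec M j = a := by
  simp only [columnVec, ← map_smul]
  rw [← map_sum]
  have : ∑ j, (Matrix.toEuclideanCLM (𝕜 := ℂ) Mᴴ a j) • EuclideanSpace.single j (1 : ℂ) =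
      Matrix.toEuclideanCLM (𝕜 := ℂ) Mᴴ a := by
    ext i
    simp [Finset.sum_apply, Pi.single_apply]
  rw [this, ← toEuclideanCLM_mul_apply, ← Matrix.star_eq_conjTranspose,
    Matrix.mem_unitaryGroup_iff.mp hM, map_one]
  rfl

/-- The Neumann operator has no resolvent on `[0, ∞)`. -/
theorem upperSqrt_im_pos [NeZero n] {z : ℂ} (hz : z ∈ resolventSet (neumannHamiltonian n)) :
    0 < (upperSqrt z).im := by
  refine (upperSqrt_im_nonneg z).lt_of_ne' fun him => ?_
  obtain ⟨R, hR⟩ := hz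
  set k := upperSqrt z with hk
  have hkz : k ^ 2 = z := upperSqrt_sq z
  set c : Cn n := EuclideanSpace.single 0 1 with hc
  have hcn : ‖c‖ = 1 := by simp [hc]
  set K : ℝ := (‖k‖ + 1) + ‖R‖ * ((2 * ‖k‖ + 1) + (‖k‖ + 1) * ‖1 + z‖) with hK
  have hK0 : 0 ≤ K := by positivity
  have key (ε : ℝ) (hε : 0 < ε) (hε1 : ε ≤ 1) : 1 / (2 * ε) ≤ K ^ 2 := by
    -- If `k` is real, `e^{iκx}` with `κ = k + iε` is almost an eigenfunction: its squared norm is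
    -- `1 / (2ε)`, while `‖κ² - z‖ ‖e‖` stays bounded.
    set κ : ℂ := k + Complex.I * ε with hκ
    have hκim : κ.im = ε := by simp [hκ, him]
    have hκpos : 0 < κ.im := by rw [hκim]; exact hε
    have hIpos : 0 < Complex.I.im := by simp
    set e := expWave κ hκpos c with he
    set d := expWave Complex.I hIpos c with hd
    have hen : ‖e‖ ^ 2 = 1 / (2 * ε) := by rw [he, norm_sq_expWave, hcn, hκim]; simp
    have hdn : ‖d‖ ≤ 1 := by
      have : ‖d‖ ^ 2 = 1 / 2 := by rw [hd, norm_sq_expWave, hcn]; simp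
      nlinarith [norm_nonneg d]
    have hκn : ‖κ‖ ≤ ‖k‖ + 1 := by
      refine (norm_add_le _ _).trans ?_
      simp only [norm_mul, Complex.norm_I, one_mul, Complex.norm_real, Real.norm_eq_abs,
        abs_of_pos hε]
      linarith
    have hde := hasWeakDeriv_expWave hκpos c
    have hdd := hasWeakDeriv_expWave hIpos c
    rw [← he] at hde
    rw [← hd, Complex.I_mul_I, neg_one_smul] at hdd
    have hbe := hasBoundaryValue_expWave hκpos c
    have hbd := hasBoundaryValue_expWave hIpos c
    rw [← he] at hbe
    rw [← hd] at hbd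
    -- The term `iκ e^{-x}` cancels the derivative of `e^{iκx}` at `0`, which puts `u` in the
    -- Neumann domain.
    set u := e + (Complex.I * κ) • d with hu
    have hmem : (u, κ ^ 2 • e + (-(Complex.I * κ)) • d) ∈ (neumannHamiltonian n).graph := by
      have h1 := (hde.smul (Complex.I * κ)).add (hdd.smul (-(Complex.I * κ)))
      have h2 := (hbe.smul (Complex.I * κ)).add (hbd.smul (-(Complex.I * κ)))
      have hI2 : Complex.I * κ * (Complex.I * κ) = -κ ^ 2 := by
        linear_combination κ ^ 2 * Complex.I_sq
      refine mem_graph_neumannHamiltonian_iff.mpr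
        ⟨_, (hde.add (hdd.smul (Complex.I * κ))).congr_right (by rw [smul_neg, ← neg_smul]),
          h1.congr_right ?_, ?_⟩
      · rw [smul_smul, hI2]
        module
      · rwa [neg_smul _ c, add_neg_cancel] at h2
    have h1 := hR.apply_of_mem_graph hmem
    have h2 : κ ^ 2 • e + (-(Complex.I * κ)) • d - z • u =
        (κ ^ 2 - z) • e + (-(Complex.I * κ * (1 + z))) • d := by
      rw [hu]
      module
    rw [h2] at h1
    have h3 : ‖u‖ ≤ ‖R‖ * (‖κ ^ 2 - z‖ * ‖e‖ + ‖κ‖ * ‖1 + z‖ * ‖d‖) := by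
      rw [← h1]
      refine (R.le_opNorm _).trans (mul_le_mul_of_nonneg_left ?_ (norm_nonneg _))
      refine (norm_add_le _ _).trans (le_of_eq ?_)
      simp only [norm_smul, norm_neg, norm_mul, Complex.norm_I, one_mul]
    have h4 : ‖e‖ ≤ ‖u‖ + ‖κ‖ * ‖d‖ := by
      have : e = u - (Complex.I * κ) • d := by rw [hu]; abel
      calc ‖e‖ = ‖u - (Complex.I * κ) • d‖ := by rw [← this]
        _ ≤ ‖u‖ + ‖(Complex.I * κ) • d‖ := norm_sub_le _ _
        _ = ‖u‖ + ‖κ‖ * ‖d‖ := by simp [norm_smul]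
    have h5 : ‖κ ^ 2 - z‖ ≤ ε * (2 * ‖k‖ + 1) := by
      have : κ ^ 2 - z = (ε : ℂ) * (2 * Complex.I * k - ε) := by
        rw [hκ, ← hkz]; ring_nf; rw [Complex.I_sq]; ring
      rw [this, norm_mul, Complex.norm_real, Real.norm_eq_abs, abs_of_pos hε]
      refine mul_le_mul_of_nonneg_left ((norm_sub_le _ _).trans ?_) hε.le
      simp only [norm_mul, Complex.norm_I, Complex.norm_real, Real.norm_eq_abs, abs_of_pos hε,
        Complex.norm_ofNat, mul_one]
      linarith
    have h6 : ε * ‖e‖ ≤ 1 := by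
      have : (ε * ‖e‖) ^ 2 ≤ 1 := by
        rw [mul_pow, hen]
        field_simp
        linarith
      nlinarith [mul_nonneg hε.le (norm_nonneg e)]
    have h7 : ‖κ ^ 2 - z‖ * ‖e‖ ≤ 2 * ‖k‖ + 1 := by
      calc ‖κ ^ 2 - z‖ * ‖e‖ ≤ ε * (2 * ‖k‖ + 1) * ‖e‖ := by gcongr
        _ = (2 * ‖k‖ + 1) * (ε * ‖e‖) := by ring
        _ ≤ (2 * ‖k‖ + 1) * 1 := by gcongr
        _ = _ := mul_one _
    have h8 : ‖e‖ ≤ K := by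
      refine h4.trans ?_
      rw [add_comm]
      refine add_le_add ?_ (h3.trans ?_)
      · exact (mul_le_mul hκn hdn (norm_nonneg _) (by positivity)).trans_eq (mul_one _)
      · refine mul_le_mul_of_nonneg_left (add_le_add h7 ?_) (norm_nonneg _)
        calc ‖κ‖ * ‖1 + z‖ * ‖d‖ ≤ (‖k‖ + 1) * ‖1 + z‖ * 1 := by gcongr
          _ = _ := mul_one _
    rw [← hen]
    gcongr
  -- This `ε` makes `1 / (2ε) = K² + 1`, contradicting the bound by `K²`.
  have h1 := key (1 / (2 * (K ^ 2 + 1))) (by positivity) (by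
    rw [div_le_one (by positivity)]
    nlinarith [sq_nonneg K])
  have h2 : 1 / (2 * (1 / (2 * (K ^ 2 + 1)))) = K ^ 2 + 1 := by
    field_simp
  linarith

/-- The zeros of the Jost function in the upper half plane are eigenvalues. -/
theorem IsDiagonalRepr.jost_ne_zero (h : IsDiagonalRepr A B M θ) {z k : ℂ} (hk : 0 < k.im)
    (hkz : k ^ 2 = z) (hz : z ∈ resolventSet (freeHamiltonian A B)) (j : Fin n) :
    (Real.cos (θ j) : ℂ) + Complex.I * k * (Real.sin (θ j) : ℂ) ≠ 0 := by
  intro h0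
  obtain ⟨R, hR⟩ := hz
  set u := expWave k hk (columnVec M j) with hu
  have hd := hasWeakDeriv_expWave hk (columnVec M j)
  have hb := hasBoundaryValue_expWave hk (columnVec M j)
  rw [← hu] at hd hb
  have hmem : (u, z • u) ∈ (freeHamiltonian A B).graph := by
    rw [freeHamiltonian_graph]
    refine ⟨_, hd, ?_, _, _, hb, hb.smul (Complex.I * k), ?_⟩
    · have := hd.smul (Complex.I * k)
      refine this.congr_right ?_
      rw [smul_smul, ← neg_smul, ← hkz]
      congr 1
      linear_combination k ^ 2 * Complex.I_sq
    · rw [h.boundary_iff]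
      intro i
      rw [map_smul, toEuclideanCLM_conjTranspose_columnVec h.unitary, PiLp.smul_apply, smul_eq_mul]
      by_cases hij : i = j
      · subst hij
        rw [← mul_assoc, ← add_mul, mul_comm (Real.sin (θ i) : ℂ), h0, zero_mul]
      · simp [hij]
  have h1 := hR.apply_of_mem_graph hmem
  rw [sub_self, map_zero] at h1
  have h2 := norm_sq_expWave hk (columnVec M j)
  rw [← hu, ← h1, norm_columnVec h.unitary] at h2
  simp only [norm_zero] at h2
  have : (0 : ℝ) < 1 ^ 2 / (2 * k.im) := by positivity
  rw [← h2] at this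
  norm_num at this

theorem neg_conj_im_pos {k : ℂ} (hk : 0 < k.im) : 0 < (-(starRingEnd ℂ) k).im := by simpa using hk

/-- The boundary value of a solution of the Neumann problem. -/
theorem inner_boundaryValue_neumann {k : ℂ} (hk : 0 < k.im) {v v' f : L2 (Cn n)}
    (h1 : HasWeakDeriv v v') (h2 : HasWeakDeriv v' (-(f + (k ^ 2) • v))) {a : Cn n}
    (ha : HasBoundaryValue v a) (hb : HasBoundaryValue v' 0) (c : Cn n) :
    (inner ℂ (expWave _ (neg_conj_im_pos hk) c) f : ℂ) = -(Complex.I * k) * inner ℂ c a := by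
  set e := expWave _ (neg_conj_im_pos hk) c with he
  have hde := hasWeakDeriv_expWave (neg_conj_im_pos hk) c
  have hbe := hasBoundaryValue_expWave (neg_conj_im_pos hk) c
  rw [← he] at hde hbe
  -- Two integrations by parts against `e^{-i k̄ x} c`. Eliminating `⟨e, v'⟩` also removes `⟨e, v⟩`
  -- and leaves the boundary value.
  have e1 := hde.inner_add_inner h1 hbe ha
  have e2 := hde.inner_add_inner h2 hbe hb
  have hconj : (starRingEnd ℂ) (Complex.I * -(starRingEnd ℂ) k) = Complex.I * k := by simp
  rw [inner_smul_left, hconj] at e1 e2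
  rw [inner_neg_right, inner_add_right, inner_smul_right, inner_zero_right] at e2
  have hI := Complex.I_sq
  linear_combination -e2 + (Complex.I * k) * e1 - k ^ 2 * inner ℂ e v * hI

/-- A Krein type formula. In the `j`-th column coordinate the boundary condition for `γ + a` and
derivative `ik a` reads `cos θ_j (γ_j + a_j) + ik sin θ_j a_j = 0`, where `γ` is the boundary value
of the Neumann solution. -/
theorem resolvent_sub_resolvent_apply (h : IsDiagonalRepr A B M θ) {z k : ℂ} (hk : 0 < k.im)
    (hkz : k ^ 2 = z) (hz : z ∈ resolventSet (freeHamiltonian A B))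
    (hz0 : z ∈ resolventSet (neumannHamiltonian n)) (f : L2 (Cn n)) :
    (resolvent (freeHamiltonian A B) z - resolvent (neumannHamiltonian n) z) f =
      ∑ j, (-(Complex.I / k * (Real.cos (θ j) : ℂ) /
        ((Real.cos (θ j) : ℂ) + Complex.I * k * (Real.sin (θ j) : ℂ))) *
        inner ℂ (expWave _ (neg_conj_im_pos hk) (columnVec M j)) f) •
        expWave k hk (columnVec M j) := by
  have hg := (resolvent_spec hz).mem_graph f
  have hg0 := (resolvent_spec hz0).mem_graph f
  rw [freeHamiltonian_graph] at hg
  rw [mem_graph_neumannHamiltonian_iff] at hg0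
  rw [sub_apply]
  set u := resolvent (freeHamiltonian A B) z f
  set v := resolvent (neumannHamiltonian n) z f
  obtain ⟨u', hu1, hu2, α, β, hα, hβ, hbc⟩ := hg
  obtain ⟨v', hv1, hv2, hδ⟩ := hg0
  simp only at hu1 hu2 hα hv1 hv2
  obtain ⟨γ, hγ⟩ := hv1.exists_hasBoundaryValue
  have hw : HasWeakDeriv (u + (-1 : ℂ) • v) (u' + (-1 : ℂ) • v') := hu1.add (hv1.smul (-1))
  have hp : HasWeakDeriv (u' + (-1 : ℂ) • v') (-(k ^ 2) • (u + (-1 : ℂ) • v)) := by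
    have := hu2.add (hv2.smul (-1))
    rw [hkz]
    exact this.congr_right (by module)
  obtain ⟨a, hwa, hpa⟩ := eq_expWave_of_hasWeakDeriv hk hw hp
  have ha1 : α + (-1 : ℂ) • γ = a := by
    refine (hα.add (hγ.smul (-1))).unique ?_
    rw [hwa]
    exact hasBoundaryValue_expWave hk a
  have hb1 : β = (Complex.I * k) • a := by
    have h1 := hβ.add (hδ.smul (-1))
    rw [smul_zero, add_zero] at h1
    refine h1.unique ?_
    rw [hpa, hwa]
    exact (hasBoundaryValue_expWave hk a).smul _
  have hα1 : α = γ + a := by rw [← ha1]; module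
  have hk0 : k ≠ 0 := by
    rintro rfl
    simp at hk
  have hcoef (j : Fin n) : Matrix.toEuclideanCLM (𝕜 := ℂ) Mᴴ a j =
      -(Complex.I / k * (Real.cos (θ j) : ℂ) /
        ((Real.cos (θ j) : ℂ) + Complex.I * k * (Real.sin (θ j) : ℂ))) *
        inner ℂ (expWave _ (neg_conj_im_pos hk) (columnVec M j)) f := by
    rw [inner_boundaryValue_neumann hk hv1 (by rw [hkz]; exact hv2) hγ hδ, inner_columnVec]
    have hj := (h.boundary_iff α β).mp hbc j
    have hne := h.jost_ne_zero hk hkz hz j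
    rw [hb1, hα1, map_add, map_smul, PiLp.add_apply, PiLp.smul_apply, smul_eq_mul] at hj
    have hI := Complex.I_sq
    field_simp
    linear_combination hj - (Real.cos (θ j) : ℂ) * Matrix.toEuclideanCLM (𝕜 := ℂ) Mᴴ γ j * hI
  have hfin : u - v = expWave k hk a := by
    rw [← hwa]; module
  rw [hfin]
  conv_lhs => rw [← sum_smul_columnVec h.unitary a]
  rw [expWave_sum]
  refine Finset.sum_congr rfl fun j _ => ?_
  rw [expWave_smul, hcoef]

end FreeResolvents

/-! ### The explicit trace norm bound for the free resolvents. -/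

section FreeBound

variable {n : ℕ} {A B M : Matrix (Fin n) (Fin n) ℂ} {θ : Fin n → ℝ}

/-- `-k̄` is a square root of `z̄` in the upper half plane; strict positivity of `Im k` excludes the
other root. -/
theorem upperSqrt_star {z : ℂ} (h : 0 < (upperSqrt z).im) :
    upperSqrt (star z) = -(starRingEnd ℂ) (upperSqrt z) := by
  have h1 : upperSqrt (star z) ^ 2 = (-(starRingEnd ℂ) (upperSqrt z)) ^ 2 := by
    rw [upperSqrt_sq, neg_sq, ← map_pow, upperSqrt_sq]; rfl
  rcases sq_eq_sq_iff_eq_or_eq_neg.mp h1 with h2 | h2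
  · exact h2
  · have h3 := upperSqrt_im_nonneg (star z)
    rw [h2, neg_neg, Complex.conj_im] at h3
    linarith

theorem jostModulus_neg_conj (k : ℂ) (t : ℝ) :
    jostModulus (-(starRingEnd ℂ) k) t = jostModulus k t := by
  rw [jostModulus, jostModulus, ← Complex.norm_conj]
  congr 1
  simp only [map_add, map_mul, map_neg, Complex.conj_ofReal, Complex.conj_I, Complex.conj_conj]
  ring

theorem inv_norm_le_boundD (θ : Fin n → ℝ) (k : ℂ) : 1 / ‖k‖ ≤ boundD θ k :=
  Finset.le_fold_max _ |>.mpr (Or.inl le_rfl)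

theorem one_le_boundF (θ : Fin n → ℝ) (k : ℂ) : 1 ≤ boundF θ k :=
  Finset.le_fold_max _ |>.mpr (Or.inl le_rfl)

theorem div_jostModulus_le_boundF (k : ℂ) {j : Fin n} (hj : IsMixed (θ j)) :
    (1 + ‖k‖) / jostModulus k (θ j) ≤ boundF θ k :=
  Finset.le_fold_max _ |>.mpr (Or.inr ⟨j, by simp [hj], le_rfl⟩)

/-- Only mixed angles need the maximum in `boundF`: for a Neumann angle the quotient is `0`, for a
Dirichlet angle it is `1`. -/
theorem abs_cos_div_jostModulus_le (k : ℂ) (j : Fin n) :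
    |Real.cos (θ j)| / jostModulus k (θ j) ≤ boundF θ (-(starRingEnd ℂ) k) := by
  by_cases hj : IsMixed (θ j)
  · refine le_trans ?_ (div_jostModulus_le_boundF _ hj)
    rw [jostModulus_neg_conj]
    refine div_le_div_of_nonneg_right ?_ (norm_nonneg _)
    exact (Real.abs_cos_le_one _).trans (le_add_of_nonneg_right (norm_nonneg _))
  · refine le_trans ?_ (one_le_boundF _ _)
    rw [IsMixed, not_and_or, not_not, not_not] at hj
    rcases hj with hj | hj
    · rw [hj]; simp
    · rw [hj]; simp [jostModulus]

theorem traceNorm_resolvent_sub_le (h : IsDiagonalRepr A B M θ) {z : ℂ}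
    (hz : z ∈ resolventSet (freeHamiltonian A B))
    (hz0 : z ∈ resolventSet (neumannHamiltonian n)) :
    traceNorm (resolvent (freeHamiltonian A B) z - resolvent (neumannHamiltonian n) z) ≤
      ENNReal.ofReal ((n + 1) * boundD θ (upperSqrt z) *
        boundF θ (upperSqrt (star z)) / (upperSqrt z).im) := by
  rcases Nat.eq_zero_or_pos n with rfl | hn
  · refine (traceNorm_le_of_forall_sum_le (C := 0) fun W _ s e _ F => ?_).trans (by simp)
    refine Finset.sum_nonpos fun i _ => ?_
    -- For `n = 0` the space is trivial and every `z` is in the resolvent set, so `Im √z > 0` may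
    -- fail; the trace norm is zero all the same.
    have : Subsingleton (L2 (Cn 0)) := ⟨fun f g => Lp.ext (Filter.Eventually.of_forall fun x =>
      Subsingleton.elim _ _)⟩
    rw [Subsingleton.elim (W (e i)) 0, inner_zero_left, norm_zero]
  · have : NeZero n := ⟨hn.ne'⟩
    have hk := upperSqrt_im_pos hz0
    have hkz := upperSqrt_sq z
    rw [upperSqrt_star hk]
    set k := upperSqrt z with hkdef
    refine (traceNorm_le_of_finite_rank
      (resolvent_sub_resolvent_apply h hk hkz hz hz0)).trans (ENNReal.ofReal_le_ofReal ?_)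
    have hk0 : 0 < ‖k‖ := norm_pos_iff.mpr fun h0 => by rw [h0] at hk; simp at hk
    have hD : 0 < boundD θ k := lt_of_lt_of_le (by positivity) (inv_norm_le_boundD θ k)
    have hF : 0 < boundF θ (-(starRingEnd ℂ) k) := zero_lt_one.trans_le (one_le_boundF _ _)
    have hterm (j : Fin n) : ‖-(Complex.I / k * (Real.cos (θ j) : ℂ) /
        ((Real.cos (θ j) : ℂ) + Complex.I * k * (Real.sin (θ j) : ℂ)))‖ *
        ((‖expWave _ (neg_conj_im_pos hk) (columnVec M j)‖ ^ 2 +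
          ‖expWave k hk (columnVec M j)‖ ^ 2) / 2) ≤
        boundD θ k * boundF θ (-(starRingEnd ℂ) k) / k.im := by
      have e1 : ‖-(Complex.I / k * (Real.cos (θ j) : ℂ) /
          ((Real.cos (θ j) : ℂ) + Complex.I * k * (Real.sin (θ j) : ℂ)))‖ =
          1 / ‖k‖ * (|Real.cos (θ j)| / jostModulus k (θ j)) := by
        rw [norm_neg, norm_div, norm_mul, norm_div, Complex.norm_I, Complex.norm_real,
          Real.norm_eq_abs, mul_div_assoc, jostModulus]
      have e2 : (‖expWave _ (neg_conj_im_pos hk) (columnVec M j)‖ ^ 2 +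
          ‖expWave k hk (columnVec M j)‖ ^ 2) / 2 = 1 / k.im / 2 := by
        rw [norm_sq_expWave, norm_sq_expWave, norm_columnVec h.unitary]
        simp only [Complex.neg_im, Complex.conj_im, neg_neg]
        field_simp
        norm_num
      rw [e1, e2]
      calc 1 / ‖k‖ * (|Real.cos (θ j)| / jostModulus k (θ j)) * (1 / k.im / 2)
          ≤ boundD θ k * boundF θ (-(starRingEnd ℂ) k) * (1 / k.im) := by
            refine mul_le_mul (mul_le_mul (inv_norm_le_boundD θ k)
              (abs_cos_div_jostModulus_le k j)
              (div_nonneg (abs_nonneg _) (norm_nonneg _)) hD.le) ?_ (by positivity) (by positivity)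
            exact half_le_self (by positivity)
        _ = _ := by rw [mul_one_div]
    refine (Finset.sum_le_sum fun j _ => hterm j).trans ?_
    rw [Finset.sum_const, Finset.card_univ, Fintype.card_fin, nsmul_eq_mul]
    refine (mul_le_mul_of_nonneg_right (lt_add_one (n : ℝ)).le (by positivity)).trans_eq ?_
    ring

end FreeBound

/-! ### The form of the free operator, its symmetry and the adjoint resolvent. -/

section FormIdentity

variable {n : ℕ} {A B M : Matrix (Fin n) (Fin n) ℂ} {θ : Fin n → ℝ}

theorem mem_formDomain_iff {u u' : L2 (Cn n)} {a : Cn n} (hu : HasWeakDeriv u u')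
    (ha : HasBoundaryValue u a) :
    u ∈ formDomain M θ ↔ ∀ j, θ j = Real.pi → Matrix.toEuclideanCLM (𝕜 := ℂ) Mᴴ a j = 0 := by
  have hb (j : Fin n) : HasBoundaryValue (component Mᴴ j u)
      (Matrix.toEuclideanCLM (𝕜 := ℂ) Mᴴ a j) := ha.compLpL _
  constructor
  · rintro ⟨-, h⟩ j hj
    obtain ⟨-, -, h0⟩ := mem_H10_iff.mp (h j hj)
    exact (hb j).unique h0
  · intro h
    refine ⟨⟨u', hu⟩, fun j hj => mem_H10_iff.mpr ⟨_, hu.compLpL _, ?_⟩⟩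
    have := hb j
    rwa [h j hj] at this

theorem inner_eq_sum_columns (hM : M ∈ Matrix.unitaryGroup (Fin n) ℂ) (x y : Cn n) :
    (inner ℂ x y : ℂ) = ∑ j, (starRingEnd ℂ) (Matrix.toEuclideanCLM (𝕜 := ℂ) Mᴴ x j) *
      Matrix.toEuclideanCLM (𝕜 := ℂ) Mᴴ y j := by
  conv_lhs => rw [← sum_smul_columnVec hM x]
  rw [sum_inner]
  simp only [inner_smul_left, inner_columnVec]

/-- The form of the free operator, by integration by parts. -/
theorem IsDiagonalRepr.form_eq (h : IsDiagonalRepr A B M θ) {u w u' v v' : L2 (Cn n)} {a b : Cn n}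
    (hmem : (u, w) ∈ freeGraph A B) (hu : HasWeakDeriv u u') (ha : HasBoundaryValue u a)
    (hvD : v ∈ formDomain M θ) (hv : HasWeakDeriv v v') (hb : HasBoundaryValue v b) :
    (inner ℂ v' u' - inner ℂ b (Matrix.toEuclideanCLM (𝕜 := ℂ) (M * bigTheta θ * Mᴴ) a) : ℂ) =
      inner ℂ v w := by
  obtain ⟨p, hp, hp', α, β, hα, hβ, hbc⟩ := hmem
  simp only at hp hp' hα
  obtain rfl := hp.unique hu
  obtain rfl := hα.unique ha
  have hibp := hv.inner_add_inner hp' hb hβ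
  have hj := (h.boundary_iff α β).mp hbc
  have hD := (mem_formDomain_iff hv hb).mp hvD
  -- Coordinate by coordinate: for a mixed angle the boundary condition says `cot θ_j α_j = -β_j`,
  -- for a Neumann angle `β_j = 0`, and for a Dirichlet angle the form domain forces `b_j = 0`.
  have key : (inner ℂ b (Matrix.toEuclideanCLM (𝕜 := ℂ) (M * bigTheta θ * Mᴴ) α) : ℂ) =
      -inner ℂ b β := by
    rw [inner_eq_sum_columns h.unitary, inner_eq_sum_columns h.unitary, ← Finset.sum_neg_distrib]
    refine Finset.sum_congr rfl fun j _ => ?_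
    have e : Matrix.toEuclideanCLM (𝕜 := ℂ) Mᴴ
        (Matrix.toEuclideanCLM (𝕜 := ℂ) (M * bigTheta θ * Mᴴ) α) =
        Matrix.toEuclideanCLM (𝕜 := ℂ) (bigTheta θ) (Matrix.toEuclideanCLM (𝕜 := ℂ) Mᴴ α) := by
      rw [← toEuclideanCLM_mul_apply, ← toEuclideanCLM_mul_apply, ← mul_assoc, ← mul_assoc,
        ← Matrix.star_eq_conjTranspose, Matrix.mem_unitaryGroup_iff'.mp h.unitary, one_mul]
    rw [e, bigTheta, toEuclideanCLM_diagonal_apply]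
    have hjj := hj j
    by_cases hm : IsMixed (θ j)
    · have hs : Real.sin (θ j) ≠ 0 := (Real.sin_pos_of_pos_of_lt_pi (h.angle j).1
        (lt_of_le_of_ne (h.angle j).2 hm.2)).ne'
      have hsC : (Real.sin (θ j) : ℂ) ≠ 0 := Complex.ofReal_ne_zero.mpr hs
      rw [if_pos hm, Real.cot_eq_cos_div_sin, Complex.ofReal_div]
      field_simp
      linear_combination (starRingEnd ℂ) (Matrix.toEuclideanCLM (𝕜 := ℂ) Mᴴ b j) * hjj
    · rw [if_neg hm, zero_mul, mul_zero]
      rw [IsMixed, not_and_or, not_not, not_not] at hm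
      rcases hm with hm | hm
      · rw [hm] at hjj
        simp only [Real.cos_pi_div_two, Real.sin_pi_div_two, Complex.ofReal_zero,
          Complex.ofReal_one, zero_mul, one_mul, zero_add] at hjj
        rw [hjj, mul_zero, neg_zero]
      · rw [hD j hm, map_zero, zero_mul, neg_zero]
  rw [inner_neg_right] at hibp
  rw [key]
  linear_combination hibp

theorem IsDiagonalRepr.fst_mem_formDomain (h : IsDiagonalRepr A B M θ) {u w : L2 (Cn n)}
    (hmem : (u, w) ∈ freeGraph A B) : u ∈ formDomain M θ := by
  obtain ⟨p, hp, hp', α, β, hα, hβ, hbc⟩ := hmem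
  refine (mem_formDomain_iff hp hα).mpr fun j hj => ?_
  have := (h.boundary_iff α β).mp hbc j
  rw [hj] at this
  simpa using this

theorem conjTranspose_bigTheta_conj :
    (M * bigTheta θ * Mᴴ)ᴴ = M * bigTheta θ * Mᴴ := by
  have : (bigTheta θ)ᴴ = bigTheta θ := by
    rw [bigTheta, Matrix.diagonal_conjTranspose]
    congr 1
    funext j
    rw [Pi.star_apply, apply_ite star, RCLike.star_def, Complex.conj_ofReal, map_zero]
  rw [Matrix.conjTranspose_mul, Matrix.conjTranspose_mul, this, Matrix.conjTranspose_conjTranspose,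
    mul_assoc]

theorem conj_inner_bigTheta (a b : Cn n) :
    (starRingEnd ℂ) (inner ℂ a (Matrix.toEuclideanCLM (𝕜 := ℂ) (M * bigTheta θ * Mᴴ) b) : ℂ) =
      inner ℂ b (Matrix.toEuclideanCLM (𝕜 := ℂ) (M * bigTheta θ * Mᴴ) a) := by
  rw [inner_conj_symm, inner_toEuclideanCLM_right, conjTranspose_bigTheta_conj]

/-- The form identity with the roles of the arguments exchanged. -/
theorem IsDiagonalRepr.form_eq' (h : IsDiagonalRepr A B M θ) {u u' v v' w : L2 (Cn n)}
    {a b : Cn n} (hmem : (v, w) ∈ freeGraph A B) (huD : u ∈ formDomain M θ)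
    (hu : HasWeakDeriv u u') (ha : HasBoundaryValue u a) (hv : HasWeakDeriv v v')
    (hb : HasBoundaryValue v b) :
    (inner ℂ v' u' - inner ℂ b (Matrix.toEuclideanCLM (𝕜 := ℂ) (M * bigTheta θ * Mᴴ) a) : ℂ) =
      inner ℂ w u := by
  have h1 := congrArg (starRingEnd ℂ) (h.form_eq hmem hv hb huD hu ha)
  rwa [map_sub, conj_inner_bigTheta, inner_conj_symm, inner_conj_symm] at h1

theorem IsDiagonalRepr.inner_symm (h : IsDiagonalRepr A B M θ) {u w v y : L2 (Cn n)}
    (hu : (u, w) ∈ freeGraph A B) (hv : (v, y) ∈ freeGraph A B) :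
    (inner ℂ v w : ℂ) = inner ℂ y u := by
  have huD := h.fst_mem_formDomain hu
  have hvD := h.fst_mem_formDomain hv
  obtain ⟨u', hu'⟩ := huD.1
  obtain ⟨v', hv'⟩ := hvD.1
  obtain ⟨a, ha⟩ := hu'.exists_hasBoundaryValue
  obtain ⟨b, hb⟩ := hv'.exists_hasBoundaryValue
  rw [← h.form_eq hu hu' ha hvD hv' hb, h.form_eq' hv huD hu' ha hv' hb]

/-- Lets the derivative estimate for form operators be applied to the free operator, with zero
potential. -/
theorem IsDiagonalRepr.freeGraph_le (h : IsDiagonalRepr A B M θ) :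
    freeGraph A B ≤ hamiltonianGraph (fun _ => 0) M θ := by
  rintro ⟨u, w⟩ hmem
  have huD := h.fst_mem_formDomain hmem
  obtain ⟨u', hu'⟩ := huD.1
  obtain ⟨a, ha⟩ := hu'.exists_hasBoundaryValue
  refine ⟨huD, u', a, hu', ha, fun v hvD v' b hv' hb => ⟨?_, ?_⟩⟩
  · simp
  · rw [formValue, h.form_eq hmem hu' ha hvD hv' hb]
    simp

/-- The conjugation `x ↦ M (M† x)‾`. -/
def columnConj (M : Matrix (Fin n) (Fin n) ℂ) : Cn n →L⋆[ℂ] Cn n where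
  toFun x := Matrix.toEuclideanCLM (𝕜 := ℂ) M
    (WithLp.toLp 2 fun j => (starRingEnd ℂ) (Matrix.toEuclideanCLM (𝕜 := ℂ) Mᴴ x j))
  map_add' x y := by
    rw [← map_add]
    congr 1
    ext j
    simp
  map_smul' c x := by
    rw [← map_smul]
    congr 1
    ext j
    simp
  cont := by
    refine (Matrix.toEuclideanCLM (𝕜 := ℂ) M).continuous.comp
      ((PiLp.continuous_toLp 2 _).comp (continuous_pi fun j => Complex.continuous_conj.comp ?_))
    exact (EuclideanSpace.proj j : Cn n →L[ℂ] ℂ).continuous.comp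
      (Matrix.toEuclideanCLM (𝕜 := ℂ) Mᴴ).continuous

theorem toEuclideanCLM_columnConj (hM : M ∈ Matrix.unitaryGroup (Fin n) ℂ) (x : Cn n) (j : Fin n) :
    Matrix.toEuclideanCLM (𝕜 := ℂ) Mᴴ (columnConj M x) j =
      (starRingEnd ℂ) (Matrix.toEuclideanCLM (𝕜 := ℂ) Mᴴ x j) := by
  show Matrix.toEuclideanCLM (𝕜 := ℂ) Mᴴ (Matrix.toEuclideanCLM (𝕜 := ℂ) M _) j = _
  rw [← toEuclideanCLM_mul_apply, ← Matrix.star_eq_conjTranspose,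
    Matrix.mem_unitaryGroup_iff'.mp hM, map_one]
  rfl

theorem columnConj_columnConj (hM : M ∈ Matrix.unitaryGroup (Fin n) ℂ) (x : Cn n) :
    columnConj M (columnConj M x) = x := by
  rw [← sum_smul_columnVec hM (columnConj M (columnConj M x))]
  simp only [toEuclideanCLM_columnConj hM, Complex.conj_conj]
  exact sum_smul_columnVec hM x

/-- The diagonal boundary condition has real coefficients, so conjugating the column coordinates
preserves it. -/
theorem IsDiagonalRepr.columnConj_mem (h : IsDiagonalRepr A B M θ) {u w : L2 (Cn n)}
    (hmem : (u, w) ∈ freeGraph A B) :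
    ((columnConj M).compLpL 2 halfLine u, (columnConj M).compLpL 2 halfLine w) ∈
      freeGraph A B := by
  obtain ⟨p, hp, hp', a, b, ha, hb, hbc⟩ := hmem
  refine ⟨_, hp.compLpL_conj (columnConj M), ?_, _, _, ha.compLpL (columnConj M),
    hb.compLpL (columnConj M), ?_⟩
  · have := hp'.compLpL_conj (columnConj M)
    exact this.congr_right (map_neg _ _)
  · rw [h.boundary_iff] at hbc ⊢
    intro j
    rw [toEuclideanCLM_columnConj h.unitary, toEuclideanCLM_columnConj h.unitary]
    have := congrArg (starRingEnd ℂ) (hbc j)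
    rwa [map_add, map_mul, map_mul, Complex.conj_ofReal, Complex.conj_ofReal, map_zero] at this

/-- The adjoint of the resolvent at `z` is the resolvent at the conjugate of `z`. -/
theorem IsDiagonalRepr.adjoint_mem (h : IsDiagonalRepr A B M θ) {z : ℂ}
    {R : L2 (Cn n) →L[ℂ] L2 (Cn n)} (hR : IsResolventAt (freeHamiltonian A B) z R)
    (g : L2 (Cn n)) :
    (R.adjoint g, g + (starRingEnd ℂ) z • R.adjoint g) ∈ freeGraph A B := by
  set J := (columnConj M).compLpL 2 halfLine with hJ
  have hJJ (f : L2 (Cn n)) : J (J f) = f := by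
    refine Lp.ext ?_
    filter_upwards [(columnConj M).coeFn_compLpL (p := 2) (μ := halfLine) (J f),
      (columnConj M).coeFn_compLpL (p := 2) (μ := halfLine) f] with x h1 h2
    rw [hJ, h1, h2, columnConj_columnConj h.unitary]
  have hgraph (f : L2 (Cn n)) : (R f, f + z • R f) ∈ freeGraph A B := by
    rw [← freeHamiltonian_graph]; exact hR.mem_graph f
  -- `J R J g` solves the equation at `z̄`, without knowing in advance that `z̄` is in the resolvent
  -- set. Symmetry then identifies `J R J` with `R*`.
  have h1 := h.columnConj_mem (hgraph (J g))
  rw [← hJ, map_add, map_smulₛₗ, hJJ] at h1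
  suffices R.adjoint g = J (R (J g)) by rwa [this]
  refine ext_inner_right ℂ fun f => ?_
  have h2 := h.inner_symm (hgraph f) h1
  rw [inner_add_left, inner_add_right, inner_smul_left, inner_smul_right, Complex.conj_conj] at h2
  rw [ContinuousLinearMap.adjoint_inner_left, ← add_right_cancel h2]

end FormIdentity

/-! ### Smoothing of the resolvents and the trace class property with a potential. -/

section Potential

variable {n : ℕ} {A B M : Matrix (Fin n) (Fin n) ℂ} {θ : Fin n → ℝ}
  {V : ℝ → Matrix (Fin n) (Fin n) ℂ}

theorem le_of_sq_le_add_mul {t S c : ℝ} (hS : 0 ≤ S) (hc : 0 ≤ c) (h : t ^ 2 ≤ S ^ 2 + c * S * t) :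
    t ≤ (1 + c) * S := by
  by_contra! hlt
  have h0 : 0 ≤ (1 + c) * S := by positivity
  have ht : 0 < t := h0.trans_lt hlt
  nlinarith [mul_lt_mul_of_pos_right hlt ht, mul_nonneg hc hS]

/-- The `L²` norm of the derivative is controlled by the graph norm. -/
theorem norm_deriv_le_of_mem_hamiltonianGraph
    (hV : IntegrableOn (fun x => Matrix.toEuclideanCLM (𝕜 := ℂ) (V x)) (Ioi 0))
    {u w u' : L2 (Cn n)} (hmem : (u, w) ∈ hamiltonianGraph V M θ) (hu : HasWeakDeriv u u') :
    ‖u'‖ ≤ (1 + 2 * (‖Matrix.toEuclideanCLM (𝕜 := ℂ) (M * bigTheta θ * Mᴴ)‖ +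
      ∫ x in Ioi (0 : ℝ), ‖Matrix.toEuclideanCLM (𝕜 := ℂ) (V x)‖)) * (‖u‖ + ‖w‖) := by
  obtain ⟨hD, p, a, hp, ha, h⟩ := hmem
  simp only at hD hp ha h
  obtain rfl := hp.unique hu
  -- The form is tested on `u` itself. By the pointwise bound the boundary and potential terms are
  -- at most linear in `‖u'‖`, so the square `‖u'‖²` dominates.
  obtain ⟨-, hf⟩ := h u hD p a hp ha
  obtain ⟨y, hyc, huy, rfl⟩ := ha
  set S := Matrix.toEuclideanCLM (𝕜 := ℂ) (M * bigTheta θ * Mᴴ)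
  have hsup (x : ℝ) (hx : 0 ≤ x) : ‖y x‖ ^ 2 ≤ 2 * (‖u‖ * ‖p‖) := hp.norm_sq_le huy hyc hx
  have h1 : ‖(inner ℂ (y 0) (S (y 0)) : ℂ)‖ ≤ ‖S‖ * (2 * (‖u‖ * ‖p‖)) := by
    calc ‖(inner ℂ (y 0) (S (y 0)) : ℂ)‖ ≤ ‖y 0‖ * (‖S‖ * ‖y 0‖) :=
          (norm_inner_le_norm _ _).trans (by gcongr; exact S.le_opNorm _)
      _ = ‖S‖ * ‖y 0‖ ^ 2 := by ring
      _ ≤ _ := by gcongr; exact hsup 0 le_rfl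
  have h2 : ‖∫ x in Ioi (0 : ℝ), (inner ℂ (u x) (Matrix.toEuclideanCLM (𝕜 := ℂ) (V x) (u x)) : ℂ)‖ ≤
      (∫ x in Ioi (0 : ℝ), ‖Matrix.toEuclideanCLM (𝕜 := ℂ) (V x)‖) * (2 * (‖u‖ * ‖p‖)) := by
    rw [← integral_mul_const]
    refine norm_integral_le_of_norm_le (hV.norm.mul_const _) ?_
    filter_upwards [huy, ae_restrict_mem measurableSet_Ioi] with x hx hx0
    rw [hx]
    calc ‖(inner ℂ (y x) (Matrix.toEuclideanCLM (𝕜 := ℂ) (V x) (y x)) : ℂ)‖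
        ≤ ‖y x‖ * (‖Matrix.toEuclideanCLM (𝕜 := ℂ) (V x)‖ * ‖y x‖) :=
          (norm_inner_le_norm _ _).trans (by gcongr; exact ContinuousLinearMap.le_opNorm _ _)
      _ = ‖Matrix.toEuclideanCLM (𝕜 := ℂ) (V x)‖ * ‖y x‖ ^ 2 := by ring
      _ ≤ _ := by gcongr; exact hsup x (le_of_lt hx0)
  have hI : 0 ≤ ∫ x in Ioi (0 : ℝ), ‖Matrix.toEuclideanCLM (𝕜 := ℂ) (V x)‖ :=
    integral_nonneg fun x => norm_nonneg _
  set I := ∫ x in Ioi (0 : ℝ), ‖Matrix.toEuclideanCLM (𝕜 := ℂ) (V x)‖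
  have h3 : ‖(inner ℂ u w : ℂ)‖ ≤ ‖u‖ * ‖w‖ := norm_inner_le_norm _ _
  have h4 : (inner ℂ p p : ℂ) = inner ℂ u w + inner ℂ (y 0) (S (y 0)) -
      ∫ x in Ioi (0 : ℝ), (inner ℂ (u x) (Matrix.toEuclideanCLM (𝕜 := ℂ) (V x) (u x)) : ℂ) := by
    rw [← hf, formValue]
    ring
  have h5 : ‖p‖ ^ 2 ≤ ‖u‖ * ‖w‖ + (‖S‖ + I) * (2 * (‖u‖ * ‖p‖)) := by
    have e : ‖p‖ ^ 2 = ‖(inner ℂ p p : ℂ)‖ := by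
      rw [inner_self_eq_norm_sq_to_K]; simp
    rw [e, h4]
    have := norm_sub_le (inner ℂ u w + inner ℂ (y 0) (S (y 0)))
      (∫ x in Ioi (0 : ℝ), (inner ℂ (u x) (Matrix.toEuclideanCLM (𝕜 := ℂ) (V x) (u x)) : ℂ))
    have := norm_add_le (inner ℂ u w : ℂ) (inner ℂ (y 0) (S (y 0)))
    linarith
  refine le_of_sq_le_add_mul (by positivity) (by positivity) (h5.trans ?_)
  have h6 : ‖u‖ * ‖w‖ ≤ (‖u‖ + ‖w‖) ^ 2 := by
    nlinarith [norm_nonneg u, norm_nonneg w]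
  have h7 : (‖S‖ + I) * (2 * (‖u‖ * ‖p‖)) ≤ 2 * (‖S‖ + I) * (‖u‖ + ‖w‖) * ‖p‖ := by
    have : (‖S‖ + I) * (2 * (‖u‖ * ‖p‖)) ≤ (‖S‖ + I) * (2 * ((‖u‖ + ‖w‖) * ‖p‖)) := by
      gcongr
      exact le_add_of_nonneg_right (norm_nonneg _)
    linarith
  linarith

/-- An operator into the first Sobolev space, with the bound that controls pointwise values. -/
def SmoothingBound (S : L2 (Cn n) →L[ℂ] L2 (Cn n)) (K : ℝ) : Prop :=
  ∀ f, ∃ f', HasWeakDeriv (S f) f' ∧ 2 * (‖S f‖ * ‖f'‖) ≤ K * ‖f‖ ^ 2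

/-- The graph norm of `S f` is at most a multiple of `‖f‖`, and it controls the derivative. -/
theorem exists_smoothingBound
    (hV : IntegrableOn (fun x => Matrix.toEuclideanCLM (𝕜 := ℂ) (V x)) (Ioi 0))
    {S : L2 (Cn n) →L[ℂ] L2 (Cn n)} {z : ℂ}
    (hS : ∀ f, (S f, f + z • S f) ∈ hamiltonianGraph V M θ) :
    ∃ K, 0 ≤ K ∧ SmoothingBound S K := by
  set c := 1 + 2 * (‖Matrix.toEuclideanCLM (𝕜 := ℂ) (M * bigTheta θ * Mᴴ)‖ +
      ∫ x in Ioi (0 : ℝ), ‖Matrix.toEuclideanCLM (𝕜 := ℂ) (V x)‖) with hc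
  have hc0 : 0 ≤ c := by
    have : 0 ≤ ∫ x in Ioi (0 : ℝ), ‖Matrix.toEuclideanCLM (𝕜 := ℂ) (V x)‖ :=
      integral_nonneg fun x => norm_nonneg _
    positivity
  refine ⟨2 * (‖S‖ * (c * (‖S‖ + (1 + ‖z‖ * ‖S‖)))), by positivity, fun f => ?_⟩
  obtain ⟨⟨f', hf'⟩, -⟩ := (hS f).1
  refine ⟨f', hf', ?_⟩
  have h1 := norm_deriv_le_of_mem_hamiltonianGraph hV (hS f) hf'
  rw [← hc] at h1
  have h2 : ‖S f‖ ≤ ‖S‖ * ‖f‖ := S.le_opNorm f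
  have h3 : ‖f + z • S f‖ ≤ (1 + ‖z‖ * ‖S‖) * ‖f‖ := by
    refine (norm_add_le _ _).trans ?_
    rw [norm_smul]
    nlinarith [norm_nonneg z]
  have h4 : ‖f'‖ ≤ c * (‖S‖ + (1 + ‖z‖ * ‖S‖)) * ‖f‖ := by
    refine h1.trans ?_
    rw [mul_assoc]
    refine mul_le_mul_of_nonneg_left ?_ hc0
    linarith
  calc 2 * (‖S f‖ * ‖f'‖)
      ≤ 2 * ((‖S‖ * ‖f‖) * (c * (‖S‖ + (1 + ‖z‖ * ‖S‖)) * ‖f‖)) := by gcongr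
    _ = _ := by ring

/-- The contraction of the polar decomposition need not keep a family orthonormal. It is absorbed
into the operator instead. -/
theorem SmoothingBound.comp {S : L2 (Cn n) →L[ℂ] L2 (Cn n)} {K : ℝ} (hK : 0 ≤ K)
    (hS : SmoothingBound S K) {W : L2 (Cn n) →L[ℂ] L2 (Cn n)} (hW : ‖W‖ ≤ 1) :
    SmoothingBound (S ∘L W) K := fun f => by
  obtain ⟨f', h1, h2⟩ := hS (W f)
  refine ⟨f', h1, h2.trans (mul_le_mul_of_nonneg_left ?_ hK)⟩
  have : ‖W f‖ ≤ ‖f‖ := (W.le_opNorm f).trans (mul_le_of_le_one_left (norm_nonneg _) hW)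
  gcongr

/-- Bessel's inequality for the pointwise values of the images of an orthonormal family. -/
theorem SmoothingBound.ae_sum_norm_sq_le {S : L2 (Cn n) →L[ℂ] L2 (Cn n)} {K : ℝ}
    (hK : 0 ≤ K) (hS : SmoothingBound S K) {ι : Type*} {e : ι → L2 (Cn n)} (he : Orthonormal ℂ e)
    (F : Finset ι) : ∀ᵐ x ∂halfLine, ∑ i ∈ F, ‖S (e i) x‖ ^ 2 ≤ n * K := by
  have hrep : ∀ i, ∃ y : ℝ → Cn n, ContinuousOn y (Ici 0) ∧ S (e i) =ᵐ[halfLine] y := fun i => by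
    obtain ⟨f', hf', -⟩ := hS (e i)
    obtain ⟨y, hy⟩ := hf'.exists_isPrimitiveRep
    exact ⟨y, hy.continuousOn, hy.ae_eq⟩
  choose y hyc hy using hrep
  have hae : ∀ᵐ x ∂halfLine, ∀ i ∈ F, S (e i) x = y i x :=
    (Filter.eventually_all_finset F).mpr fun i _ => hy i
  filter_upwards [hae, ae_restrict_mem measurableSet_Ioi] with x hx hx0
  have hcoord (j : Fin n) : ∑ i ∈ F, ‖y i x j‖ ^ 2 ≤ K := by
    -- The extremal coefficients: `f = ∑ a_i e_i` has `‖f‖² = s`, and the `j`-th entry of `S f` at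
    -- `x` is also `s`. The pointwise bound becomes `s² ≤ K s`.
    set a : ι → ℂ := fun i => (starRingEnd ℂ) (y i x j) with ha
    set s := ∑ i ∈ F, ‖y i x j‖ ^ 2 with hs
    set f := ∑ i ∈ F, a i • e i with hf
    have hfn : ‖f‖ ^ 2 = s := by
      have h1 : (inner ℂ f f : ℂ) = ∑ i ∈ F, (starRingEnd ℂ) (a i) * a i := he.inner_sum a a F
      have h2 : (inner ℂ f f : ℂ) = ((‖f‖ ^ 2 : ℝ) : ℂ) := by
        rw [inner_self_eq_norm_sq_to_K]; simp
      rw [h2] at h1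
      refine Complex.ofReal_injective (h1.trans ?_)
      rw [hs, Complex.ofReal_sum]
      refine Finset.sum_congr rfl fun i _ => ?_
      rw [ha, Complex.conj_conj, Complex.mul_conj, Complex.normSq_eq_norm_sq]
    obtain ⟨f', hf', hb⟩ := hS f
    have hrepf : S f =ᵐ[halfLine] fun t => ∑ i ∈ F, a i • y i t := by
      have h1 : S f = ∑ i ∈ F, a i • S (e i) := by rw [hf, map_sum]; simp only [map_smul]
      have h2 : ∀ᵐ t ∂halfLine, ∀ i ∈ F, (a i • S (e i) : L2 (Cn n)) t = a i • y i t := by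
        refine (Filter.eventually_all_finset F).mpr fun i _ => ?_
        filter_upwards [Lp.coeFn_smul (a i) (S (e i)), hy i] with t h3 h4
        rw [h3, Pi.smul_apply, h4]
      rw [h1]
      filter_upwards [Lp.coeFn_finsetSum F fun i => a i • S (e i), h2] with t h3 h4
      rw [h3, Finset.sum_apply]
      exact Finset.sum_congr rfl h4
    have hcont : ContinuousOn (fun t => ∑ i ∈ F, a i • y i t) (Ici 0) :=
      continuousOn_finsetSum F fun i _ => (hyc i).const_smul (a i)
    have h1 := (hf'.norm_sq_le hrepf hcont (le_of_lt hx0)).trans hb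
    rw [hfn] at h1
    have h2 : s ≤ ‖∑ i ∈ F, a i • y i x‖ := by
      have h3 : (∑ i ∈ F, a i • y i x) j = (s : ℂ) := by
        rw [WithLp.ofLp_sum, Finset.sum_apply, hs, Complex.ofReal_sum]
        refine Finset.sum_congr rfl fun i _ => ?_
        rw [PiLp.smul_apply, smul_eq_mul, ha, mul_comm, Complex.mul_conj,
          Complex.normSq_eq_norm_sq]
      have h4 := PiLp.norm_apply_le (∑ i ∈ F, a i • y i x) j
      rw [h3, Complex.norm_real] at h4
      exact (le_abs_self s).trans h4
    have hs0 : 0 ≤ s := Finset.sum_nonneg fun i _ => sq_nonneg _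
    have h5 : s ^ 2 ≤ K * s := (by gcongr : s ^ 2 ≤ _).trans h1
    rcases hs0.eq_or_lt with h0 | h0
    · rwa [← h0]
    · nlinarith
  calc ∑ i ∈ F, ‖S (e i) x‖ ^ 2 = ∑ i ∈ F, ∑ j, ‖y i x j‖ ^ 2 :=
        Finset.sum_congr rfl fun i hi => by rw [hx i hi, EuclideanSpace.norm_sq_eq]
    _ = ∑ j, ∑ i ∈ F, ‖y i x j‖ ^ 2 := Finset.sum_comm
    _ ≤ ∑ _j : Fin n, K := Finset.sum_le_sum fun j _ => hcoord j
    _ = n * K := by simp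

/-- The second resolvent identity, in weak form. -/
theorem IsDiagonalRepr.inner_resolvent_sub (h : IsDiagonalRepr A B M θ) {z : ℂ}
    {R R₀ : L2 (Cn n) →L[ℂ] L2 (Cn n)} (hR : IsResolventAt (hamiltonian V M θ) z R)
    (hR₀ : IsResolventAt (freeHamiltonian A B) z R₀) (f g : L2 (Cn n)) :
    Integrable (fun x => (inner ℂ (R₀.adjoint g x)
      (Matrix.toEuclideanCLM (𝕜 := ℂ) (V x) (R f x)) : ℂ)) halfLine ∧
    (inner ℂ g ((R - R₀) f) : ℂ) = -∫ x in Ioi (0 : ℝ), inner ℂ (R₀.adjoint g x)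
      (Matrix.toEuclideanCLM (𝕜 := ℂ) (V x) (R f x)) := by
  have hv := h.adjoint_mem hR₀ g
  have hu := hR.mem_graph f
  rw [hamiltonian_graph] at hu
  obtain ⟨huD, u', a, hu', ha, hform⟩ := hu
  have hvD := h.fst_mem_formDomain hv
  obtain ⟨v', hv'⟩ := hvD.1
  obtain ⟨b, hb⟩ := hv'.exists_hasBoundaryValue
  obtain ⟨hint, hval⟩ := hform _ hvD v' b hv' hb
  refine ⟨hint, ?_⟩
  rw [formValue, h.form_eq' hv huD hu' ha hv' hb, inner_add_left, inner_smul_left,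
    Complex.conj_conj, inner_add_right, inner_smul_right] at hval
  rw [sub_apply, inner_sub_right, ← ContinuousLinearMap.adjoint_inner_left R₀]
  linear_combination hval

/-- The integrand of the resolvent identity is at most `‖V(x)‖ ‖(R₀* W e_i)(x)‖ ‖(R e_i)(x)‖`. Its
sum over `i` is bounded by `‖V(x)‖` times a constant, by the pointwise Bessel inequality for both
operators. -/
theorem IsDiagonalRepr.isTraceClass_resolvent_sub (h : IsDiagonalRepr A B M θ)
    (hV : IntegrableOn (fun x => Matrix.toEuclideanCLM (𝕜 := ℂ) (V x)) (Ioi 0)) {z : ℂ}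
    {R R₀ : L2 (Cn n) →L[ℂ] L2 (Cn n)} (hR : IsResolventAt (hamiltonian V M θ) z R)
    (hR₀ : IsResolventAt (freeHamiltonian A B) z R₀) : IsTraceClass (R - R₀) := by
  obtain ⟨K, hK, hRK⟩ := exists_smoothingBound hV (S := R) (z := z) (M := M) (θ := θ) fun f => by
    rw [← hamiltonian_graph]; exact hR.mem_graph f
  have h0 : IntegrableOn (fun _ : ℝ =>
      Matrix.toEuclideanCLM (𝕜 := ℂ) (0 : Matrix (Fin n) (Fin n) ℂ)) (Ioi 0) := by
    simp only [map_zero]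
    exact integrable_zero ℝ (Cn n →L[ℂ] Cn n) _
  obtain ⟨K₀, hK₀, hRK₀⟩ := exists_smoothingBound (V := fun _ => 0) h0 (S := R₀.adjoint)
    (z := (starRingEnd ℂ) z) (M := M) (θ := θ) fun f => h.freeGraph_le (h.adjoint_mem hR₀ f)
  refine (traceNorm_le_of_forall_sum_le
    (C := ∫ x in Ioi (0 : ℝ), ‖Matrix.toEuclideanCLM (𝕜 := ℂ) (V x)‖ * ((n * K₀ + n * K) / 2))
    fun W hW s e he F => ?_).trans_lt ENNReal.ofReal_lt_top
  have hi (i : s) := (h.inner_resolvent_sub hR hR₀ (e i) (W (e i))).1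
  calc ∑ i ∈ F, ‖(inner ℂ (W (e i)) ((R - R₀) (e i)) : ℂ)‖
      ≤ ∑ i ∈ F, ∫ x in Ioi (0 : ℝ), ‖(inner ℂ (R₀.adjoint (W (e i)) x)
          (Matrix.toEuclideanCLM (𝕜 := ℂ) (V x) (R (e i) x)) : ℂ)‖ := by
        refine Finset.sum_le_sum fun i _ => ?_
        rw [(h.inner_resolvent_sub hR hR₀ (e i) (W (e i))).2, norm_neg]
        exact norm_integral_le_integral_norm _
    _ = ∫ x in Ioi (0 : ℝ), ∑ i ∈ F, ‖(inner ℂ (R₀.adjoint (W (e i)) x)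
          (Matrix.toEuclideanCLM (𝕜 := ℂ) (V x) (R (e i) x)) : ℂ)‖ :=
        (integral_finsetSum F fun i _ => (hi i).norm).symm
    _ ≤ _ := by
        refine integral_mono_ae (integrable_finsetSum F fun i _ => (hi i).norm)
          (hV.norm.mul_const _) ?_
        filter_upwards [hRK.ae_sum_norm_sq_le hK he F,
          (hRK₀.comp hK₀ hW).ae_sum_norm_sq_le hK₀ he F] with x h1 h2
        have h3 (i : s) : ‖(inner ℂ (R₀.adjoint (W (e i)) x)
            (Matrix.toEuclideanCLM (𝕜 := ℂ) (V x) (R (e i) x)) : ℂ)‖ ≤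
            ‖Matrix.toEuclideanCLM (𝕜 := ℂ) (V x)‖ *
              ((‖R₀.adjoint (W (e i)) x‖ ^ 2 + ‖R (e i) x‖ ^ 2) / 2) := by
          refine (norm_inner_le_norm _ _).trans ?_
          calc ‖R₀.adjoint (W (e i)) x‖ * ‖Matrix.toEuclideanCLM (𝕜 := ℂ) (V x) (R (e i) x)‖
              ≤ ‖R₀.adjoint (W (e i)) x‖ *
                (‖Matrix.toEuclideanCLM (𝕜 := ℂ) (V x)‖ * ‖R (e i) x‖) := by
                gcongr; exact ContinuousLinearMap.le_opNorm _ _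
            _ = ‖Matrix.toEuclideanCLM (𝕜 := ℂ) (V x)‖ *
                (‖R₀.adjoint (W (e i)) x‖ * ‖R (e i) x‖) := by ring
            _ ≤ _ := by
                gcongr
                nlinarith [sq_nonneg (‖R₀.adjoint (W (e i)) x‖ - ‖R (e i) x‖)]
        refine (Finset.sum_le_sum fun i _ => h3 i).trans ?_
        rw [← Finset.mul_sum, ← Finset.sum_div, Finset.sum_add_distrib]
        refine mul_le_mul_of_nonneg_left ?_ (norm_nonneg _)
        have h4 : ∑ i ∈ F, ‖R₀.adjoint (W (e i)) x‖ ^ 2 ≤ n * K₀ := h2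
        linarith

end Potential

end HalfLine

end

/-! ### The theorem. -/

theorem lemma9p1 (n : ℕ) (A B : Matrix (Fin n) (Fin n) ℂ)
    (hAB : -Bᴴ * A + Aᴴ * B = 0) (hpos : (Aᴴ * A + Bᴴ * B).PosDef)
    (V : ℝ → Matrix (Fin n) (Fin n) ℂ)
    (hV : IntegrableOn (fun x => Matrix.toEuclideanCLM (𝕜 := ℂ) (V x)) (Ioi 0))
    (hVsa : ∀ x ∈ Ioi (0 : ℝ), (V x)ᴴ = V x) :
    (∃ (M : Matrix (Fin n) (Fin n) ℂ) (θ : Fin n → ℝ), HalfLine.IsDiagonalRepr A B M θ) ∧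
    (∀ (M : Matrix (Fin n) (Fin n) ℂ) (θ : Fin n → ℝ), HalfLine.IsDiagonalRepr A B M θ →
      ∀ z ∈ HalfLine.resolventSet (HalfLine.hamiltonian V M θ) ∩
          HalfLine.resolventSet (HalfLine.freeHamiltonian A B),
        HalfLine.IsTraceClass (HalfLine.resolvent (HalfLine.hamiltonian V M θ) z -
          HalfLine.resolvent (HalfLine.freeHamiltonian A B) z)) ∧
    (∀ z ∈ HalfLine.resolventSet (HalfLine.freeHamiltonian A B) ∩
          HalfLine.resolventSet (HalfLine.neumannHamiltonian n),
        HalfLine.IsTraceClass (HalfLine.resolvent (HalfLine.freeHamiltonian A B) z -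
          HalfLine.resolvent (HalfLine.neumannHamiltonian n) z)) ∧
    ∃ C : ℝ, 0 < C ∧
      ∀ (M : Matrix (Fin n) (Fin n) ℂ) (θ : Fin n → ℝ), HalfLine.IsDiagonalRepr A B M θ →
      ∀ z ∈ HalfLine.resolventSet (HalfLine.freeHamiltonian A B) ∩
          HalfLine.resolventSet (HalfLine.neumannHamiltonian n),
        HalfLine.traceNorm (HalfLine.resolvent (HalfLine.freeHamiltonian A B) z -
            HalfLine.resolvent (HalfLine.neumannHamiltonian n) z) ≤
          ENNReal.ofReal (C * HalfLine.boundD θ (HalfLine.upperSqrt z) *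
            HalfLine.boundF θ (HalfLine.upperSqrt (star z)) / (HalfLine.upperSqrt z).im) := by
  -- The constant counts the rank one terms; it is `n + 1` rather than `n` so that it is positive
  -- also for `n = 0`.
  refine ⟨HalfLine.exists_isDiagonalRepr hAB hpos, fun M θ h z hz => ?_, fun z hz => ?_,
    n + 1, by positivity, fun M θ h z hz => ?_⟩
  · exact h.isTraceClass_resolvent_sub hV (HalfLine.resolvent_spec hz.1)
      (HalfLine.resolvent_spec hz.2)
  · obtain ⟨M, θ, h⟩ := HalfLine.exists_isDiagonalRepr hAB hpos
    exact (HalfLine.traceNorm_resolvent_sub_le h hz.1 hz.2).trans_lt ENNReal.ofReal_lt_top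
  · exact HalfLine.traceNorm_resolvent_sub_le h hz.1 hz.2
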